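/- **Setting.** Let $\mathbb T^1=\mathbb R/\mathbb Z$ and $\mathbb T^2=\mathbb R^2/\mathbb Z^2$, with geodesic distances $d_{\mathbb T^1}, d_{\mathbb T^2}$ and normalized Lebesgue measure; all integrals are with respect to Lebesgue measure on $\mathbb T^2$. Fix constants $K_0,K_1>0$ and $M_0\in\mathbb N$. Let $0<L_0\le L_1\le L_2\le\cdots$ be a nondecreasing sequence and, for each $n\ge1$, let $f_n:\mathbb R\to\mathbb R$ be a $C^3$ function for which there is an integer $d_n$ with $f_n(x+1)=f_n(x)+d_n$ for all $x$ (for $d_n=0$ this is a $C^3$ function $\mathbb T^1\to\mathbb R$; $f_n(x)=L_n\sin(2\pi x)+2x$ gives the standard map). Assume for all $n\ge1$: - (H1) $\|f_n'\|_{C^0}+\|f_n''\|_{C^0}\le K_0L_n$; - (H2) the set $\mathcal C_n=\{\hat x\in\mathbb T^1: f_n'(\hat x)=0\}$ is non-empty and has at most $M_0$ elements; - (H3) $|f_n'(x)|\ge L_nK_1^{-1}\,d_{\mathbb T^1}(x,\mathcal C_n)$ for all $x\in\mathbb T^1$. Let $F_n:\mathbb T^2\to\mathbb T^2$, $F_n(x,y)=(f_n(x)-y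 \ (\mathrm{mod}\ 1),\,x)$, and $F^n=F_n\circ\cdots\circ F_1$, $F^0=\mathrm{Id}$. For $\alpha\in(0,1]$ and an $\alpha$-Hölder function $\varphi:\mathbb T^2\to\mathbb R$ put $$[\varphi]_\alpha=\sup_{p\ne q}\frac{|\varphi(p)-\varphi(q)|}{d_{\mathbb T^2}(p,q)^\alpha},\qquad \|\varphi\|_\alpha=\|\varphi\|_{C^0}+[\varphi]_\alpha .$$ **Theorem C.** Let $K_0,K_1>0$, $M_0\in\mathbb N$ and $\eta\in(1/2,1)$. There are constants $L_0'>0$ and $C>0$, depending only on $K_0,K_1,M_0,\eta$, such that the following holds. Let $\{L_n\}_{n\ge0}$ and $\{f_n\}_{n\ge1}$ be as above, with $L_1\ge L_0'$ and $\sum_n L_n^{-\frac12(1-\eta)}<\infty$. Let $\alpha\in(0,1]$ and let $\varphi,\psi:\mathbb T^2\to\mathbb R$ be $\alpha$-Hölder continuous. Then $$\left|\int\psi\circ F^n\cdot\varphi-\int\varphi\int\psi\right|\le C\,\|\psi\|_\alpha\|\varphi\|_\alpha\max\left\{L_{\lfloor n/2\rfloor}^{1-2\eta},\ \Big(\sum_{i=\lfloor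 n/8\rfloor}^\infty L_i^{-\frac12(1-\eta)}\Big)^{\frac{\alpha}{\alpha+2}}\right\}$$ for all $n\ge2$, and, if $L_0\le L_0'$, for all $n\ge0$. -/

import Mathlib

/-- The flat torus `ℝ² / ℤ²`. Its `volume` is the normalized Lebesgue measure. -/
abbrev Torus2 : Type := UnitAddCircle × UnitAddCircle

/-- The set of critical points of `f` (a lift of a circle map), as a subset of the circle. -/
def criticalSet (f : ℝ → ℝ) : Set UnitAddCircle :=
  (fun x : ℝ => (x : UnitAddCircle)) '' {x : ℝ | deriv f x = 0}

/-- The standing conditions on the `C³` function `f` with coefficient `ℓ`. The function is given on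
the real line; it is either `1`-periodic (a real-valued function on the circle) or, as for
`ℓ sin (2 π x) + 2 x`, it advances by an integer over a period. Only `f` modulo `1` and the
(periodic) derivatives of `f` matter. -/
structure AdmissibleKick (K₀ K₁ : ℝ) (M₀ : ℕ) (ℓ : ℝ) (f : ℝ → ℝ) : Prop where
  contDiff : ContDiff ℝ 3 f
  degree : ∃ d : ℤ, ∀ x : ℝ, f (x + 1) = f x + d
  /-- `‖f'‖_{C⁰} + ‖f''‖_{C⁰} ≤ K₀ ℓ`, the two suprema being taken independently. -/
  upper : ∀ x y : ℝ, |deriv f x| + |deriv (deriv f) y| ≤ K₀ * ℓ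
  /-- The critical set is finite with at most `M₀` points. -/
  card_le : (criticalSet f).encard ≤ M₀
  /-- The critical set is non-empty. For a periodic `f` this is automatic; in general it is what
  the next condition says under the convention that the distance to the empty set is infinite. -/
  nonempty : (criticalSet f).Nonempty
  /-- `|f'(x)| ≥ ℓ K₁⁻¹ d(x, C)` with `C` the critical set. -/
  lower : ∀ x : ℝ, ℓ * K₁⁻¹ * Metric.infDist (x : UnitAddCircle) (criticalSet f) ≤ |deriv f x|

/-- The torus map `(x, y) ↦ (f x - y mod 1, x)`, with the circle parametrized by `[0, 1)`. -/
noncomputable def kickMap (f : ℝ → ℝ) (p : Torus2) : Torus2 :=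
  (((f (AddCircle.equivIco (1 : ℝ) 0 p.1 : ℝ) : ℝ) : UnitAddCircle) - p.2, p.1)

/-- The composition `F^n = F_n ∘ ⋯ ∘ F_1`, where `F_k = kickMap (f k)`, and `F^0 = id`. -/
noncomputable def kickComp (f : ℕ → ℝ → ℝ) : ℕ → Torus2 → Torus2
  | 0 => id
  | n + 1 => kickMap (f (n + 1)) ∘ kickComp f n

/-- The geodesic distance of the flat torus (the `dist` of the product type is the sup distance). -/
noncomputable def torusDist (p q : Torus2) : ℝ :=
  √(dist p.1 q.1 ^ 2 + dist p.2 q.2 ^ 2)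

/-- `φ` is `α`-Hölder continuous on the torus. -/
def IsHolder (α : ℝ) (φ : Torus2 → ℝ) : Prop :=
  ∃ K : ℝ, ∀ p q : Torus2, |φ p - φ q| ≤ K * torusDist p q ^ α

/-- The Hölder modulus `[φ]_α` (a finite supremum when `φ` is `α`-Hölder). -/
noncomputable def holderSeminorm (α : ℝ) (φ : Torus2 → ℝ) : ℝ :=
  ⨆ z : Torus2 × Torus2, |φ z.1 - φ z.2| / torusDist z.1 z.2 ^ α

/-- The Hölder norm `‖φ‖_α = ‖φ‖_{C⁰} + [φ]_α`. -/
noncomputable def holderNorm (α : ℝ) (φ : Torus2 → ℝ) : ℝ :=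
  (⨆ p : Torus2, |φ p|) + holderSeminorm α φ

/-!
Write `F_j` for the `j`-th kick map, `T` for the tail `∑_{i ≥ n/8} L_i ^ (-(1 - η)/2)` and set
`Λ_j = L_j ^ (1 - (1 - η)/2)`. When `T > 1`, or when `n < 2` and `L_0 ≤ L_0'`, the maximum on the
right is bounded below and the claim is the trivial bound by the suprema. Otherwise the correlation
is at most a constant times `T ^ (α / (α + 2))`.

Start at time `m = n/8`: `φ` is transported there by the inverse of `F^m`, which is Lipschitz with
constant `N = ∏_{j ≤ m} (K₀ L_j + 1)`. Along a horizontal line, parametrized by `x`, the later orbit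
is given by real functions `X_j` of `x` with `X_{j+1} = f_j(X_j) - X_{j-1}`. Where each slope
`|f_j'(X_j)|` is at least `Λ_j`, the derivative `X_j'` grows at least by the factor `Λ_j / 2` in each
step (`orbitSlope_growth`), and `X_j''` is small compared with `(X_j')²` (`orbitBend_le`). A smooth
cutoff `χ` restricts to such orbits. Since the maps preserve Lebesgue measure, it discards only the
sum of the measures of the critical strips `{|f_j'| < 2 Λ_j}`, which is of order `T`
(`integral_one_sub_torusCutoff_le`, `AdmissibleKick.volume_le`).

Let `h` be an observable of mean zero on horizontal lines. It is the derivative `∂_s Ψ` of a function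
`Ψ` on the torus, so `χ h(X_{k+1}, X_k)` is, up to small terms, the derivative of the periodic
function `χ Ψ(X_{k+1}, X_k) / X_{k+1}'`, and its integral is small (`abs_integral_orbit_le`). The
cutoff costs little in this integration by parts, because its derivative at step `j` is dominated by
`X_{j+1}'` (`hasDerivAt_orbitCutoff`). For Hölder functions, `φ` is first averaged horizontally and
`h` vertically (`abs_integral_mul_kickComp_le`). With averaging lengths `T ^ (1/(α+2)) / N` and
`T ^ (1/(α+2))` the averaging errors are of order `T ^ (α/(α+2))`, and all others of order `T`; the
constant `N` is absorbed since the growth over more than `4 m` steps exceeds it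
(`prod_mul_sqrt_le_prod`).

An arbitrary observable `ψ` is split into its deviation from the mean over horizontal lines, and that
mean, which depends on the second coordinate only. The second coordinate of `F^n` is the first
coordinate of `F^(n-1)`, so the estimate applies to both parts, at times `n` and `n - 1`
(`abs_correlation_le_stripTail`).
-/

open MeasureTheory

/-! ### Real lifts of circle points and the kick maps -/

instance isProbabilityMeasure_unitAddCircle :
    IsProbabilityMeasure (volume : Measure UnitAddCircle) := ⟨UnitAddCircle.measure_univ⟩

/-- `f` is the lift of a circle map: it advances by a fixed integer over a period. -/
def IsCircleLift (f : ℝ → ℝ) : Prop := ∃ d : ℤ, ∀ x : ℝ, f (x + 1) = f x + d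

theorem coe_add_int (x : ℝ) (k : ℤ) : ((x + k : ℝ) : UnitAddCircle) = x := by
  have : ((k : ℝ) : UnitAddCircle) = 0 := (AddCircle.coe_eq_zero_iff (1 : ℝ)).2 ⟨k, by simp⟩
  rw [AddCircle.coe_add, this, add_zero]

theorem exists_int_of_coe_eq {x y : ℝ} (h : (x : UnitAddCircle) = y) : ∃ k : ℤ, x = y + k := by
  have h' : ((x - y : ℝ) : UnitAddCircle) = 0 := by rw [AddCircle.coe_sub, h, sub_self]
  obtain ⟨k, hk⟩ := (AddCircle.coe_eq_zero_iff (1 : ℝ)).1 h'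
  exact ⟨k, by simp at hk; linarith⟩

namespace IsCircleLift

variable {f : ℝ → ℝ}

theorem exists_add_int (hf : IsCircleLift f) (x : ℝ) (k : ℤ) :
    ∃ l : ℤ, f (x + k) = f x + l := by
  obtain ⟨d, hd⟩ := hf
  refine ⟨k * d, ?_⟩
  induction k using Int.induction_on with
  | zero => simp
  | succ n ih =>
    have := hd (x + n)
    push_cast at ih ⊢
    rw [← add_assoc, this, ih]; ring
  | pred n ih =>
    have := hd (x + (-n - 1))
    push_cast at ih ⊢
    rw [show x + (-(n : ℝ) - 1) + 1 = x + -n by ring, ih] at this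
    linarith

theorem coe_eq_of_coe_eq (hf : IsCircleLift f) {x y : ℝ} (h : (x : UnitAddCircle) = y) :
    (f x : UnitAddCircle) = f y := by
  obtain ⟨k, rfl⟩ := exists_int_of_coe_eq h
  obtain ⟨l, hl⟩ := hf.exists_add_int y k
  rw [hl, coe_add_int]

theorem deriv_add_one (hf : IsCircleLift f) (x : ℝ) : deriv f (x + 1) = deriv f x := by
  obtain ⟨d, hd⟩ := hf
  rw [← deriv_comp_add_const, funext hd, deriv_add_const]

theorem deriv_eq_of_coe_eq (hf : IsCircleLift f) {x y : ℝ} (h : (x : UnitAddCircle) = y) :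
    deriv f x = deriv f y := by
  obtain ⟨k, rfl⟩ := exists_int_of_coe_eq h
  simpa using (show Function.Periodic (deriv f) 1 from hf.deriv_add_one).int_mul k y

end IsCircleLift

/-- The representative in `[0, 1)` of a point of the circle. -/
noncomputable def circleRep (z : UnitAddCircle) : ℝ := (AddCircle.equivIco (1 : ℝ) 0 z : ℝ)

theorem coe_circleRep (z : UnitAddCircle) : (circleRep z : UnitAddCircle) = z :=
  AddCircle.coe_equivIco

theorem measurable_circleRep : Measurable circleRep :=
  measurable_subtype_coe.comp (AddCircle.measurableEquivIco (1 : ℝ) 0).measurable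

/-- The lifts that realize the distance may lie on different sides of an integer, so they are not
both taken in `[0, 1)`. -/
theorem exists_lifts_dist (z w : UnitAddCircle) :
    ∃ x y : ℝ, (x : UnitAddCircle) = z ∧ (y : UnitAddCircle) = w ∧ |x - y| = dist z w := by
  refine ⟨circleRep z, circleRep w + round (circleRep z - circleRep w), coe_circleRep z, ?_, ?_⟩
  · rw [coe_add_int, coe_circleRep]
  · rw [dist_eq_norm]
    conv_rhs => rw [← coe_circleRep z, ← coe_circleRep w, ← AddCircle.coe_sub]
    rw [UnitAddCircle.norm_eq]
    congr 1; ring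

theorem dist_coe_le (x y : ℝ) : dist (x : UnitAddCircle) y ≤ |x - y| := by
  rw [dist_eq_norm, ← AddCircle.coe_sub, UnitAddCircle.norm_eq]
  simpa using round_le (x - y) 0

theorem kickMap_eq (f : ℝ → ℝ) (p : Torus2) :
    kickMap f p = ((f (circleRep p.1) : UnitAddCircle) - p.2, p.1) := rfl

theorem kickMap_coe {f : ℝ → ℝ} (hf : IsCircleLift f) (x y : ℝ) :
    kickMap f ((x : UnitAddCircle), (y : UnitAddCircle)) = (((f x - y : ℝ) : UnitAddCircle), ↑x) := by
  rw [kickMap_eq, hf.coe_eq_of_coe_eq (coe_circleRep (x : UnitAddCircle)), AddCircle.coe_sub]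

theorem measurable_coe_circle : Measurable (fun x : ℝ => (x : UnitAddCircle)) :=
  (AddCircle.continuous_mk' (1 : ℝ)).measurable

theorem measurePreserving_kickMap {f : ℝ → ℝ} (hf : Measurable f) :
    MeasurePreserving (kickMap f) := by
  have h1 : MeasurePreserving (fun p : Torus2 => (p.1, (f (circleRep p.1) : UnitAddCircle) - p.2)) := by
    refine (MeasurePreserving.id volume).skew_product (g := fun a b =>
      (f (circleRep a) : UnitAddCircle) - b) ?_ (Filter.Eventually.of_forall fun a => ?_)
    · exact ((measurable_coe_circle.comp (hf.comp measurable_circleRep)).comp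
        measurable_fst).sub measurable_snd
    · exact (Measure.measurePreserving_sub_left volume (f (circleRep a) : UnitAddCircle)).map_eq
  exact Measure.measurePreserving_swap.comp h1

/-- The inverse of `kickMap f`. -/
noncomputable def kickInv (f : ℝ → ℝ) (p : Torus2) : Torus2 :=
  (p.2, (f (circleRep p.2) : UnitAddCircle) - p.1)

theorem kickInv_kickMap (f : ℝ → ℝ) (p : Torus2) : kickInv f (kickMap f p) = p := by
  simp [kickInv, kickMap_eq]

theorem dist_kickInv_le {f : ℝ → ℝ} (hf : IsCircleLift f) (hd : Differentiable ℝ f) {K : ℝ}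
    (hK : ∀ x, |deriv f x| ≤ K) (p q : Torus2) :
    dist (kickInv f p) (kickInv f q) ≤ (K + 1) * dist p q := by
  have hK0 : 0 ≤ K := (abs_nonneg _).trans (hK 0)
  have h1 : dist p.1 q.1 ≤ dist p q := le_max_left _ _
  have h2 : dist p.2 q.2 ≤ dist p q := le_max_right _ _
  have h0 : 0 ≤ dist p q := dist_nonneg
  refine max_le (h2.trans (by nlinarith)) ?_
  obtain ⟨x, y, hx, hy, hxy⟩ := exists_lifts_dist p.2 q.2
  have e1 : (f (circleRep p.2) : UnitAddCircle) = f x :=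
    hf.coe_eq_of_coe_eq ((coe_circleRep _).trans hx.symm)
  have e2 : (f (circleRep q.2) : UnitAddCircle) = f y :=
    hf.coe_eq_of_coe_eq ((coe_circleRep _).trans hy.symm)
  have e3 : |f x - f y| ≤ K * |x - y| := by
    simpa using Convex.norm_image_sub_le_of_norm_deriv_le (s := Set.univ) (C := K)
      (fun x _ => hd x) (fun x _ => hK x) convex_univ (Set.mem_univ y) (Set.mem_univ x)
  calc dist ((f (circleRep p.2) : UnitAddCircle) - p.1) ((f (circleRep q.2) : UnitAddCircle) - q.1)
      ≤ dist (f x : UnitAddCircle) (f y) + dist p.1 q.1 := by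
        rw [e1, e2]; exact dist_sub_sub_le _ _ _ _
    _ ≤ K * dist p q + dist p q := by
        refine add_le_add ((dist_coe_le _ _).trans (e3.trans ?_)) h1
        rw [hxy]; gcongr
    _ = _ := by ring

/-- The inverse of `kickComp f n`. -/
noncomputable def kickCompInv (f : ℕ → ℝ → ℝ) : ℕ → Torus2 → Torus2
  | 0 => id
  | n + 1 => kickCompInv f n ∘ kickInv (f (n + 1))

theorem kickCompInv_kickComp (f : ℕ → ℝ → ℝ) (n : ℕ) (p : Torus2) :
    kickCompInv f n (kickComp f n p) = p := by
  induction n with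
  | zero => rfl
  | succ n ih => simp [kickCompInv, kickComp, kickInv_kickMap, ih]

theorem dist_kickCompInv_le {f : ℕ → ℝ → ℝ} {K : ℕ → ℝ} {n : ℕ}
    (hf : ∀ j, 1 ≤ j → j ≤ n → IsCircleLift (f j) ∧ Differentiable ℝ (f j) ∧
      ∀ x, |deriv (f j) x| ≤ K j) (p q : Torus2) :
    dist (kickCompInv f n p) (kickCompInv f n q) ≤
      (∏ j ∈ Finset.range n, (K (j + 1) + 1)) * dist p q := by
  induction n generalizing p q with
  | zero => simp [kickCompInv]
  | succ n ih =>
    obtain ⟨h1, h2, h3⟩ := hf (n + 1) (by omega) le_rfl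
    refine (ih (fun j h h' => hf j h (by omega)) _ _).trans ?_
    rw [Finset.prod_range_succ, mul_assoc]
    refine mul_le_mul_of_nonneg_left (dist_kickInv_le h1 h2 h3 p q) ?_
    refine Finset.prod_nonneg fun j hj => ?_
    have := (abs_nonneg _).trans ((hf (j + 1) (by omega) (by have := Finset.mem_range.1 hj; omega)).2.2 0)
    linarith

theorem measurePreserving_kickComp {f : ℕ → ℝ → ℝ} {n : ℕ}
    (hf : ∀ j, 1 ≤ j → j ≤ n → Measurable (f j)) : MeasurePreserving (kickComp f n) := by
  induction n with
  | zero => exact MeasurePreserving.id _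
  | succ n ih =>
    exact (measurePreserving_kickMap (hf (n + 1) (by omega) le_rfl)).comp
      (ih fun j h h' => hf j h (by omega))

theorem kickComp_add (f : ℕ → ℝ → ℝ) (m k : ℕ) (p : Torus2) :
    kickComp f (m + k) p = kickComp (fun j => f (m + j)) k (kickComp f m p) := by
  induction k with
  | zero => rfl
  | succ k ih => rw [← add_assoc]; simp [kickComp, ih, add_assoc]

/-! ### Hölder functions on the torus -/

theorem torusDist_nonneg (p q : Torus2) : 0 ≤ torusDist p q := Real.sqrt_nonneg _

theorem torusDist_le (p q : Torus2) : torusDist p q ≤ 2 * dist p q := by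
  have h1 : dist p.1 q.1 ≤ dist p q := le_max_left _ _
  have h2 : dist p.2 q.2 ≤ dist p q := le_max_right _ _
  refine Real.sqrt_le_iff.2 ⟨by positivity, ?_⟩
  nlinarith [dist_nonneg (x := p.1) (y := q.1), dist_nonneg (x := p.2) (y := q.2)]

theorem torusDist_pos {p q : Torus2} (h : p ≠ q) : 0 < torusDist p q := by
  refine Real.sqrt_pos.2 ?_
  by_contra! hle
  have h1 : dist p.1 q.1 = 0 := by nlinarith [sq_nonneg (dist p.1 q.1), sq_nonneg (dist p.2 q.2)]
  have h2 : dist p.2 q.2 = 0 := by nlinarith [sq_nonneg (dist p.1 q.1), sq_nonneg (dist p.2 q.2)]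
  exact h (Prod.ext (dist_eq_zero.1 h1) (dist_eq_zero.1 h2))

namespace IsHolder

variable {α : ℝ} {φ : Torus2 → ℝ}

theorem abs_sub_le (h : IsHolder α φ) (hα : 0 < α) (p q : Torus2) :
    |φ p - φ q| ≤ holderSeminorm α φ * torusDist p q ^ α := by
  obtain ⟨K, hK⟩ := h
  rcases eq_or_ne p q with rfl | hpq
  · have : torusDist p p = 0 := by simp [torusDist]
    simp [this, Real.zero_rpow hα.ne']
  have hpos : 0 < torusDist p q ^ α := Real.rpow_pos_of_pos (torusDist_pos hpq) _
  have hbdd : BddAbove (Set.range fun z : Torus2 × Torus2 =>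
      |φ z.1 - φ z.2| / torusDist z.1 z.2 ^ α) := by
    refine ⟨max K 0, ?_⟩
    rintro _ ⟨z, rfl⟩
    refine div_le_of_le_mul₀ (Real.rpow_nonneg (torusDist_nonneg _ _) _) (le_max_right _ _) ?_
    refine (hK _ _).trans ?_
    gcongr
    · exact Real.rpow_nonneg (torusDist_nonneg _ _) _
    · exact le_max_left _ _
  exact (div_le_iff₀ hpos).1 (le_ciSup hbdd (p, q))

theorem continuous (h : IsHolder α φ) (hα : 0 < α) : Continuous φ := by
  obtain ⟨K, hK⟩ := h
  rw [continuous_iff_continuousAt]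
  intro p
  rw [ContinuousAt, tendsto_iff_dist_tendsto_zero]
  have : Filter.Tendsto (fun q => |K| * (2 * dist q p) ^ α) (nhds p) (nhds 0) := by
    have hc : Continuous fun q : Torus2 => |K| * (2 * dist q p) ^ α := by
      refine continuous_const.mul (Continuous.rpow_const (by fun_prop) fun _ => Or.inr hα.le)
    simpa [Real.zero_rpow hα.ne'] using hc.tendsto p
  refine squeeze_zero (fun _ => dist_nonneg) (fun q => ?_) this
  refine (hK q p).trans ?_
  have h1 := Real.rpow_le_rpow (torusDist_nonneg q p) (torusDist_le q p) hα.le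
  have h2 := Real.rpow_nonneg (torusDist_nonneg q p) α
  nlinarith [le_abs_self K, abs_nonneg K]

theorem seminorm_nonneg (φ : Torus2 → ℝ) : 0 ≤ holderSeminorm α φ :=
  Real.iSup_nonneg fun _ => div_nonneg (abs_nonneg _) (Real.rpow_nonneg (torusDist_nonneg _ _) _)

theorem abs_le (h : IsHolder α φ) (hα : 0 < α) (p : Torus2) : |φ p| ≤ holderNorm α φ := by
  have hb : BddAbove (Set.range fun p => |φ p|) :=
    (isCompact_range (h.continuous hα).abs).bddAbove
  have := le_ciSup hb p
  have h2 := seminorm_nonneg (α := α) φ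
  unfold holderNorm
  linarith

theorem norm_nonneg (φ : Torus2 → ℝ) : 0 ≤ holderNorm α φ :=
  add_nonneg (Real.iSup_nonneg fun _ => abs_nonneg _) (seminorm_nonneg φ)

theorem abs_sub_le_dist (h : IsHolder α φ) (hα : 0 < α) (p q : Torus2) :
    |φ p - φ q| ≤ holderNorm α φ * (2 * dist p q) ^ α := by
  refine (h.abs_sub_le hα p q).trans ?_
  have h1 := Real.rpow_le_rpow (torusDist_nonneg p q) (torusDist_le p q) hα.le
  have h2 : holderSeminorm α φ ≤ holderNorm α φ :=
    le_add_of_nonneg_left (Real.iSup_nonneg fun _ => abs_nonneg _)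
  exact mul_le_mul h2 h1 (Real.rpow_nonneg (torusDist_nonneg p q) α) (norm_nonneg φ)

end IsHolder

/-! ### The size of the critical strips -/

/-- By the lower bound on `|f'|`, the strip where `|f'| < r` lies within distance `K₁ r / ℓ` of the
at most `M₀` critical points. -/
theorem AdmissibleKick.volume_le {K₀ K₁ ℓ : ℝ} {M₀ : ℕ} {f : ℝ → ℝ}
    (h : AdmissibleKick K₀ K₁ M₀ ℓ f) (hK₁ : 0 < K₁) (hℓ : 0 < ℓ) {r : ℝ} (hr : 0 ≤ r) :
    volume.real {z : UnitAddCircle | |deriv f (circleRep z)| < r} ≤ M₀ * (2 * (K₁ * r / ℓ)) := by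
  have hfin : (criticalSet f).Finite := by
    apply Set.finite_of_encard_le_coe h.card_le
  have hcard : (hfin.toFinset.card : ℝ) ≤ M₀ := by
    have := h.card_le
    rw [hfin.encard_eq_coe_toFinset_card] at this
    exact_mod_cast this
  have hsub : {z : UnitAddCircle | |deriv f (circleRep z)| < r} ⊆
      ⋃ c ∈ hfin.toFinset, Metric.closedBall c (K₁ * r / ℓ) := by
    intro z hz
    have h1 := h.lower (circleRep z)
    rw [coe_circleRep] at h1
    obtain ⟨c, hc, hd⟩ := hfin.isCompact.exists_infDist_eq_dist h.nonempty z
    simp only [Set.mem_iUnion, Set.Finite.mem_toFinset]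
    refine ⟨c, hc, ?_⟩
    rw [Metric.mem_closedBall, ← hd, le_div_iff₀ hℓ]
    have h2 : ℓ * K₁⁻¹ * Metric.infDist z (criticalSet f) < r := h1.trans_lt hz
    have h3 : K₁ * (ℓ * K₁⁻¹ * Metric.infDist z (criticalSet f)) ≤ K₁ * r := by gcongr
    calc _ = K₁ * (ℓ * K₁⁻¹ * Metric.infDist z (criticalSet f)) := by field_simp
      _ ≤ _ := h3
  have hrad : 0 ≤ K₁ * r / ℓ := by positivity
  calc volume.real {z : UnitAddCircle | |deriv f (circleRep z)| < r}
      ≤ volume.real (⋃ c ∈ hfin.toFinset, Metric.closedBall c (K₁ * r / ℓ)) :=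
        measureReal_mono hsub (measure_ne_top _ _)
    _ ≤ ∑ c ∈ hfin.toFinset, volume.real (Metric.closedBall c (K₁ * r / ℓ)) :=
        measureReal_biUnion_finset_le _ _
    _ ≤ ∑ c ∈ hfin.toFinset, 2 * (K₁ * r / ℓ) := by
        refine Finset.sum_le_sum fun c _ => ?_
        rw [Measure.real, AddCircle.volume_closedBall, ENNReal.toReal_ofReal (by positivity)]
        exact min_le_right _ _
    _ ≤ _ := by
        rw [Finset.sum_const, nsmul_eq_mul]
        gcongr

/-! ### Orbits of horizontal lines -/

/-- The first coordinates of the orbit of `(x, y)`, lifted to the real line: `X₀ = y`, `X₁ = x` and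
`X_{j+2} = g_{j+1} X_{j+1} - X_j`. The `k`-th image of `(x, y)` is `(X_{k+1}, X_k)` modulo `1`. -/
noncomputable def liftOrbit (g : ℕ → ℝ → ℝ) (y x : ℝ) : ℕ → ℝ
  | 0 => y
  | 1 => x
  | j + 2 => g (j + 1) (liftOrbit g y x (j + 1)) - liftOrbit g y x j

/-- The derivative of `liftOrbit g y x` in `x`. -/
noncomputable def orbitSlope (g : ℕ → ℝ → ℝ) (y x : ℝ) : ℕ → ℝ
  | 0 => 0
  | 1 => 1
  | j + 2 => deriv (g (j + 1)) (liftOrbit g y x (j + 1)) * orbitSlope g y x (j + 1)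
      - orbitSlope g y x j

/-- The second derivative of `liftOrbit g y x` in `x`. -/
noncomputable def orbitBend (g : ℕ → ℝ → ℝ) (y x : ℝ) : ℕ → ℝ
  | 0 => 0
  | 1 => 0
  | j + 2 => deriv (deriv (g (j + 1))) (liftOrbit g y x (j + 1)) * orbitSlope g y x (j + 1) ^ 2
      + deriv (g (j + 1)) (liftOrbit g y x (j + 1)) * orbitBend g y x (j + 1) - orbitBend g y x j

/-- What is used of a kick: it is a `C²` circle lift whose second derivative is at most `S Λ²`, where
`Λ` is the threshold from which on a slope counts as expanding. -/
structure KickBound (S Λ : ℝ) (f : ℝ → ℝ) : Prop where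
  contDiff : ContDiff ℝ 2 f
  lift : IsCircleLift f
  threshold : 16 ≤ Λ
  second : ∀ x, |deriv (deriv f) x| ≤ S * Λ ^ 2

namespace KickBound

variable {S Λ : ℝ} {f : ℝ → ℝ}

theorem hasDerivAt (h : KickBound S Λ f) (x : ℝ) : HasDerivAt f (deriv f x) x :=
  (h.contDiff.differentiable (by norm_num) x).hasDerivAt

theorem contDiff_deriv (h : KickBound S Λ f) : ContDiff ℝ 1 (deriv f) :=
  ((contDiff_succ_iff_deriv (n := 1)).1 h.contDiff).2.2

theorem hasDerivAt_deriv (h : KickBound S Λ f) (x : ℝ) :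
    HasDerivAt (deriv f) (deriv (deriv f) x) x :=
  (h.contDiff_deriv.differentiable (by norm_num) x).hasDerivAt

theorem nonneg (h : KickBound S Λ f) : 0 ≤ S := by
  have h1 := (abs_nonneg _).trans (h.second 0)
  have h2 := h.threshold
  exact nonneg_of_mul_nonneg_left h1 (by positivity)

end KickBound

section

variable {g : ℕ → ℝ → ℝ} {y : ℝ} {k : ℕ} {S : ℝ} {Λ : ℕ → ℝ}

theorem kickComp_coe (hg : ∀ j < k, IsCircleLift (g (j + 1))) (x y : ℝ) :
    kickComp g k ((x : UnitAddCircle), (y : UnitAddCircle)) =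
      ((liftOrbit g y x (k + 1) : UnitAddCircle), (liftOrbit g y x k : UnitAddCircle)) := by
  induction k with
  | zero => rfl
  | succ k ih =>
    rw [kickComp, Function.comp_apply, ih fun j hj => hg j (by omega),
      kickMap_coe (hg k (by omega)), liftOrbit]

theorem hasDerivAt_liftOrbit (hg : ∀ j < k, KickBound S (Λ (j + 1)) (g (j + 1))) (x : ℝ) :
    HasDerivAt (fun x => liftOrbit g y x k) (orbitSlope g y x k) x ∧
      HasDerivAt (fun x => liftOrbit g y x (k + 1)) (orbitSlope g y x (k + 1)) x := by
  induction k with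
  | zero => exact ⟨hasDerivAt_const x y, hasDerivAt_id x⟩
  | succ k ih =>
    obtain ⟨h0, h1⟩ := ih fun j hj => hg j (by omega)
    exact ⟨h1, (((hg k (by omega)).hasDerivAt _).comp x h1).sub h0⟩

theorem hasDerivAt_orbitSlope (hg : ∀ j < k, KickBound S (Λ (j + 1)) (g (j + 1))) (x : ℝ) :
    HasDerivAt (fun x => orbitSlope g y x k) (orbitBend g y x k) x ∧
      HasDerivAt (fun x => orbitSlope g y x (k + 1)) (orbitBend g y x (k + 1)) x := by
  induction k with
  | zero => exact ⟨hasDerivAt_const x 0, hasDerivAt_const x 1⟩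
  | succ k ih =>
    obtain ⟨h0, h1⟩ := ih fun j hj => hg j (by omega)
    have hX := (hasDerivAt_liftOrbit (y := y) (k := k) (fun j hj => hg j (by omega)) x).2
    refine ⟨h1, (((((hg k (by omega)).hasDerivAt_deriv _).comp x hX).mul h1).sub h0).congr_deriv ?_⟩
    simp only [orbitBend, Function.comp_apply]
    ring

theorem coe_liftOrbit_add_one (hg : ∀ j < k, IsCircleLift (g (j + 1))) (x : ℝ) :
    (liftOrbit g y (x + 1) (k + 1) : UnitAddCircle) = liftOrbit g y x (k + 1) ∧
    (liftOrbit g y (x + 1) k : UnitAddCircle) = liftOrbit g y x k := by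
  have h := kickComp_coe hg (x + 1) y
  rw [show ((x + 1 : ℝ) : UnitAddCircle) = x by simp, kickComp_coe hg x y,
    Prod.mk.injEq] at h
  exact ⟨h.1.symm, h.2.symm⟩

theorem orbitSlope_add_one (hg : ∀ j < k, IsCircleLift (g (j + 1))) (x : ℝ) :
    orbitSlope g y (x + 1) k = orbitSlope g y x k ∧
      orbitSlope g y (x + 1) (k + 1) = orbitSlope g y x (k + 1) := by
  induction k with
  | zero => exact ⟨rfl, rfl⟩
  | succ k ih =>
    obtain ⟨h0, h1⟩ := ih fun j hj => hg j (by omega)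
    refine ⟨h1, ?_⟩
    rw [orbitSlope, orbitSlope, h0, h1, (hg k (by omega)).deriv_eq_of_coe_eq
      (coe_liftOrbit_add_one (k := k) (fun j hj => hg j (by omega)) x).1]

/-- Along an orbit whose slopes stay above the threshold, the derivative grows by at least half the
slope in each step. -/
theorem orbitSlope_growth {x : ℝ} (hΛ : ∀ j < k, 16 ≤ Λ (j + 1))
    (hx : ∀ j < k, Λ (j + 1) ≤ |deriv (g (j + 1)) (liftOrbit g y x (j + 1))|) :
    (∀ j < k, |deriv (g (j + 1)) (liftOrbit g y x (j + 1))| / 2 * |orbitSlope g y x (j + 1)| ≤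
      |orbitSlope g y x (j + 2)|) ∧
    (∀ j ≤ k, |orbitSlope g y x j| ≤ |orbitSlope g y x (j + 1)|) ∧
    ∏ j ∈ Finset.range k, (Λ (j + 1) / 2) ≤ |orbitSlope g y x (k + 1)| := by
  induction k with
  | zero =>
    refine ⟨fun j hj => absurd hj (Nat.not_lt_zero _), fun j hj => ?_, by simp [orbitSlope]⟩
    obtain rfl : j = 0 := by omega
    simp [orbitSlope]
  | succ k ih =>
    obtain ⟨h1, h2, h3⟩ := ih (fun j hj => hΛ j (by omega)) fun j hj => hx j (by omega)
    have hk := h2 k le_rfl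
    have hΛk := hΛ k (by omega)
    have hxk := hx k (by omega)
    have hu := abs_nonneg (orbitSlope g y x (k + 1))
    have key : |deriv (g (k + 1)) (liftOrbit g y x (k + 1))| / 2 * |orbitSlope g y x (k + 1)| ≤
        |orbitSlope g y x (k + 2)| := by
      have := abs_sub_abs_le_abs_sub (deriv (g (k + 1)) (liftOrbit g y x (k + 1))
        * orbitSlope g y x (k + 1)) (orbitSlope g y x k)
      rw [abs_mul] at this
      rw [orbitSlope]
      nlinarith
    refine ⟨fun j hj => ?_, fun j hj => ?_, ?_⟩
    · rcases Nat.lt_succ_iff_lt_or_eq.1 hj with h | rfl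
      · exact h1 j h
      · exact key
    · rcases Nat.le_succ_iff_eq_or_le.1 hj with rfl | h
      · refine le_trans ?_ key
        nlinarith
      · exact h2 j h
    · rw [Finset.prod_range_succ, mul_comm]
      refine le_trans ?_ key
      gcongr
      exact Finset.prod_nonneg fun j hj => by
        have := hΛ j (by have := Finset.mem_range.1 hj; omega)
        linarith

/-- Distortion: the second derivative of an expanding orbit is controlled by the square of the
first. -/
theorem orbitBend_le {x : ℝ} (hS : 0 ≤ S) (hg : ∀ j < k, KickBound S (Λ (j + 1)) (g (j + 1)))
    (hx : ∀ j < k, Λ (j + 1) ≤ |deriv (g (j + 1)) (liftOrbit g y x (j + 1))|) :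
    |orbitBend g y x k| ≤ 8 * S * orbitSlope g y x k ^ 2 ∧
      |orbitBend g y x (k + 1)| ≤ 8 * S * orbitSlope g y x (k + 1) ^ 2 := by
  induction k with
  | zero => simpa [orbitBend, orbitSlope] using hS
  | succ k ih =>
    have hk := hg k (by omega)
    obtain ⟨h0, h1⟩ := ih (fun j hj => hg j (by omega)) fun j hj => hx j (by omega)
    refine ⟨h1, ?_⟩
    obtain ⟨hgr, hmono, -⟩ := orbitSlope_growth (fun j hj => (hg j hj).threshold) hx
    have hgk := hgr k (by omega)
    have hmk := hmono k (by omega)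
    have hxk := hx k (by omega)
    have h2 := hk.second (liftOrbit g y x (k + 1))
    have hΛ := hk.threshold
    rw [orbitBend]
    set a := deriv (g (k + 1)) (liftOrbit g y x (k + 1))
    set e := deriv (deriv (g (k + 1))) (liftOrbit g y x (k + 1))
    set u := orbitSlope g y x (k + 1)
    set u0 := orbitSlope g y x k
    set w := orbitSlope g y x (k + 2)
    have hu0 : u0 ^ 2 ≤ u ^ 2 := sq_le_sq.2 hmk
    have hw : (|a| / 2 * |u|) ^ 2 ≤ w ^ 2 := by
      rw [← sq_abs w]; gcongr
    have hw' : |a| ^ 2 * u ^ 2 ≤ 4 * w ^ 2 := by rw [← sq_abs u]; nlinarith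
    have he : |e| ≤ S * |a| ^ 2 := h2.trans (by gcongr)
    calc |e * u ^ 2 + a * orbitBend g y x (k + 1) - orbitBend g y x k|
        ≤ |e| * u ^ 2 + |a| * |orbitBend g y x (k + 1)| + |orbitBend g y x k| := by
          refine (abs_sub _ _).trans (add_le_add ((abs_add_le _ _).trans ?_) le_rfl)
          rw [abs_mul, abs_mul, abs_of_nonneg (sq_nonneg u)]
      _ ≤ S * |a| ^ 2 * u ^ 2 + |a| * (8 * S * u ^ 2) + 8 * S * u ^ 2 := by
          gcongr
          exact h0.trans (by gcongr)
      _ = S * u ^ 2 * (|a| ^ 2 + 8 * |a| + 8) := by ring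
      _ ≤ S * u ^ 2 * (2 * |a| ^ 2) := by gcongr; nlinarith
      _ = 2 * S * (|a| ^ 2 * u ^ 2) := by ring
      _ ≤ 2 * S * (4 * w ^ 2) := by gcongr
      _ = 8 * S * w ^ 2 := by ring

/-! ### The cutoff to expanding orbits -/

/-- A smooth function that vanishes on `[-1, 1]` and is `1` outside `[-2, 2]`. -/
noncomputable def slopeCutoff (t : ℝ) : ℝ := Real.smoothTransition (t ^ 2 - 1)

theorem contDiff_slopeCutoff : ContDiff ℝ 1 slopeCutoff :=
  Real.smoothTransition.contDiff.comp (by fun_prop : ContDiff ℝ 1 fun t : ℝ => t ^ 2 - 1)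

theorem slopeCutoff_nonneg (t : ℝ) : 0 ≤ slopeCutoff t := Real.smoothTransition.nonneg _

theorem slopeCutoff_le_one (t : ℝ) : slopeCutoff t ≤ 1 := Real.smoothTransition.le_one _

theorem slopeCutoff_eq_zero {t : ℝ} (h : |t| ≤ 1) : slopeCutoff t = 0 :=
  Real.smoothTransition.zero_of_nonpos (by nlinarith [sq_abs t, abs_nonneg t])

theorem slopeCutoff_eq_one {t : ℝ} (h : 2 ≤ |t|) : slopeCutoff t = 1 :=
  Real.smoothTransition.one_of_one_le (by nlinarith [sq_abs t, abs_nonneg t])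

theorem exists_deriv_slopeCutoff_le : ∃ c : ℝ, 0 < c ∧ ∀ t, |deriv slopeCutoff t| ≤ c := by
  obtain ⟨c, hc⟩ := (isCompact_Icc (a := (-2 : ℝ)) (b := 2)).exists_bound_of_continuousOn
    (contDiff_slopeCutoff.continuous_deriv (by norm_num)).continuousOn
  refine ⟨max c 1, by positivity, fun t => ?_⟩
  rcases le_or_gt |t| 2 with h | h
  · exact (hc t (abs_le.1 h)).trans (le_max_left _ _)
  · have : slopeCutoff =ᶠ[nhds t] fun _ => 1 := by
      filter_upwards [(continuous_abs.tendsto t).eventually (lt_mem_nhds h)] with s hs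
      exact slopeCutoff_eq_one hs.le
    rw [this.deriv_eq]
    simp

/-- The product of the cutoffs along the first `k` points of an orbit. It vanishes near each orbit
that has a slope below the threshold. -/
noncomputable def orbitCutoff (g : ℕ → ℝ → ℝ) (Λ : ℕ → ℝ) (k : ℕ) (y x : ℝ) : ℝ :=
  ∏ j ∈ Finset.range k,
    slopeCutoff (deriv (g (j + 1)) (liftOrbit g y x (j + 1)) / Λ (j + 1))

theorem orbitCutoff_nonneg (x : ℝ) : 0 ≤ orbitCutoff g Λ k y x :=
  Finset.prod_nonneg fun _ _ => slopeCutoff_nonneg _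

theorem orbitCutoff_le_one (x : ℝ) : orbitCutoff g Λ k y x ≤ 1 :=
  Finset.prod_le_one (fun _ _ => slopeCutoff_nonneg _) fun _ _ => slopeCutoff_le_one _

theorem continuous_liftOrbit (hg : ∀ j < k, KickBound S (Λ (j + 1)) (g (j + 1))) :
    Continuous fun x => liftOrbit g y x (k + 1) :=
  continuous_iff_continuousAt.2 fun x => (hasDerivAt_liftOrbit hg x).2.continuousAt

theorem continuous_orbitCutoff (hg : ∀ j < k, KickBound S (Λ (j + 1)) (g (j + 1))) :
    Continuous fun x => orbitCutoff g Λ k y x := by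
  refine continuous_finsetProd _ fun j hj => ?_
  have hj := Finset.mem_range.1 hj
  have := continuous_liftOrbit (y := y) (k := j) fun i hi => hg i (hi.trans hj)
  exact contDiff_slopeCutoff.continuous.comp
    (((hg j hj).contDiff_deriv.continuous.comp this).div_const _)

/-- The derivative of the cutoff is dominated by the next derivative of the orbit: a cutoff at step
`j` has derivative of order `S Λ_j |u_j|`, while `|u_{j+1}|` is at least `Λ_j |u_j| / 2`. -/
theorem hasDerivAt_orbitCutoff {c : ℝ} (hc : ∀ t, |deriv slopeCutoff t| ≤ c) {x : ℝ}
    (hg : ∀ j < k, KickBound S (Λ (j + 1)) (g (j + 1)))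
    (hx : ∀ j < k, Λ (j + 1) ≤ |deriv (g (j + 1)) (liftOrbit g y x (j + 1))|) :
    ∃ D : ℝ, HasDerivAt (orbitCutoff g Λ k y) D x ∧
      |D| ≤ 4 * c * |S| * |orbitSlope g y x (k + 1)| := by
  have hc0 : 0 ≤ c := (abs_nonneg _).trans (hc 0)
  induction k with
  | zero =>
    refine ⟨0, ?_, by simp; positivity⟩
    have : orbitCutoff g Λ 0 y = fun _ => 1 := by ext; simp [orbitCutoff]
    rw [this]; exact hasDerivAt_const x 1
  | succ k ih =>
    obtain ⟨D, hD, hDle⟩ := ih (fun j hj => hg j (by omega)) fun j hj => hx j (by omega)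
    have hk := hg k (by omega)
    have hX := (hasDerivAt_liftOrbit (y := y) (k := k) (fun j hj => hg j (by omega)) x).2
    obtain ⟨hgr, -, -⟩ := orbitSlope_growth (fun j hj => (hg j hj).threshold) hx
    have hgk := hgr k (by omega)
    have hxk := hx k (by omega)
    have hΛ := hk.threshold
    have h2 := hk.second (liftOrbit g y x (k + 1))
    have hS := hk.nonneg
    rw [abs_of_nonneg hS] at hDle ⊢
    have hρ : HasDerivAt
        (fun x => slopeCutoff (deriv (g (k + 1)) (liftOrbit g y x (k + 1)) / Λ (k + 1)))
        (deriv slopeCutoff (deriv (g (k + 1)) (liftOrbit g y x (k + 1)) / Λ (k + 1)) *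
          (deriv (deriv (g (k + 1))) (liftOrbit g y x (k + 1)) * orbitSlope g y x (k + 1)
            / Λ (k + 1))) x := by
      have h := (contDiff_slopeCutoff.differentiable (by norm_num)
        (deriv (g (k + 1)) (liftOrbit g y x (k + 1)) / Λ (k + 1))).hasDerivAt
      exact HasDerivAt.comp (h₂ := slopeCutoff) x h
        (((hk.hasDerivAt_deriv _).comp x hX).div_const (Λ (k + 1)))
    have hfun : orbitCutoff g Λ (k + 1) y = fun x => orbitCutoff g Λ k y x *
        slopeCutoff (deriv (g (k + 1)) (liftOrbit g y x (k + 1)) / Λ (k + 1)) := by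
      ext x; exact Finset.prod_range_succ _ _
    rw [hfun]
    refine ⟨_, hD.mul hρ, ?_⟩
    set a := deriv (g (k + 1)) (liftOrbit g y x (k + 1))
    set e := deriv (deriv (g (k + 1))) (liftOrbit g y x (k + 1))
    set u := orbitSlope g y x (k + 1)
    set w := orbitSlope g y x (k + 2)
    set l := Λ (k + 1)
    have hl : 0 < l := by linarith
    have he : |e * u / l| ≤ S * l * |u| := by
      rw [abs_div, abs_mul, abs_of_pos hl, div_le_iff₀ hl]
      calc |e| * |u| ≤ S * l ^ 2 * |u| := by gcongr
        _ = _ := by ring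
    have hw : l * |u| ≤ 2 * |w| := by nlinarith [abs_nonneg u]
    calc |D * slopeCutoff (a / l) + orbitCutoff g Λ k y x * (deriv slopeCutoff (a / l) * (e * u / l))|
        ≤ |D| * 1 + 1 * (c * (S * l * |u|)) := by
          refine (abs_add_le _ _).trans ?_
          rw [abs_mul, abs_mul, abs_mul, abs_of_nonneg (slopeCutoff_nonneg _),
            abs_of_nonneg (orbitCutoff_nonneg _)]
          gcongr
          · exact slopeCutoff_le_one _
          · exact orbitCutoff_le_one _
          · exact hc _
      _ ≤ 4 * c * S * |u| + c * S * (l * |u|) := by linarith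
      _ ≤ 2 * (c * S) * (l * |u|) := by
          have : c * S * (4 * |u|) ≤ c * S * (l * |u|) := by gcongr; linarith
          linarith
      _ ≤ 2 * (c * S) * (2 * |w|) := by gcongr
      _ = 4 * c * S * |w| := by ring

end

/-! ### Integration by parts along a horizontal line -/

/-- `Ψ` is a differentiable function on the plane with period `1` in both variables, and its partial
derivatives are `h`, which is continuous, and `Ψ₂`. -/
structure IsPeriodicPrimitive (Ψ h Ψ₂ : ℝ → ℝ → ℝ) : Prop where
  hasFDerivAt : ∀ s t, HasFDerivAt (fun p : ℝ × ℝ => Ψ p.1 p.2)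
    (h s t • ContinuousLinearMap.fst ℝ ℝ ℝ + Ψ₂ s t • ContinuousLinearMap.snd ℝ ℝ ℝ) (s, t)
  continuous : Continuous fun p : ℝ × ℝ => h p.1 p.2
  periodic : ∀ s t s' t' : ℝ, (s : UnitAddCircle) = s' → (t : UnitAddCircle) = t' →
    Ψ s t = Ψ s' t'

section

variable {g : ℕ → ℝ → ℝ} {y : ℝ} {k : ℕ} {S : ℝ} {Λ : ℕ → ℝ}

theorem orbitCutoff_add_one (hg : ∀ j < k, IsCircleLift (g (j + 1))) (x : ℝ) :
    orbitCutoff g Λ k y (x + 1) = orbitCutoff g Λ k y x := by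
  refine Finset.prod_congr rfl fun j hj => ?_
  have hj := Finset.mem_range.1 hj
  rw [(hg j hj).deriv_eq_of_coe_eq
    (coe_liftOrbit_add_one (k := j) (fun i hi => hg i (hi.trans hj)) x).1]

theorem orbitCutoff_eventually_eq_zero (hg : ∀ j < k, KickBound S (Λ (j + 1)) (g (j + 1))) {x : ℝ}
    (hx : ∃ j < k, |deriv (g (j + 1)) (liftOrbit g y x (j + 1))| < Λ (j + 1)) :
    ∀ᶠ z in nhds x, orbitCutoff g Λ k y z = 0 := by
  obtain ⟨j, hj, hlt⟩ := hx
  have hc : Continuous fun z => |deriv (g (j + 1)) (liftOrbit g y z (j + 1))| :=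
    ((hg j hj).contDiff_deriv.continuous.comp
      (continuous_liftOrbit (k := j) fun i hi => hg i (hi.trans hj))).abs
  filter_upwards [(hc.tendsto x).eventually (gt_mem_nhds hlt)] with z hz
  refine Finset.prod_eq_zero (Finset.mem_range.2 hj) (slopeCutoff_eq_zero ?_)
  have hΛ : 0 < Λ (j + 1) := by linarith [(hg j hj).threshold]
  rw [abs_div, abs_of_pos hΛ, div_le_one hΛ]
  exact hz.le

/-- Integration by parts: `a χ h(X_{k+1}, X_k)` is the derivative of the periodic function
`a χ Ψ(X_{k+1}, X_k) / X_{k+1}'` up to a small remainder, `χ` being the cutoff. -/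
theorem abs_integral_orbit_le {c : ℝ} (hc : ∀ t, |deriv slopeCutoff t| ≤ c)
    (hk : 1 ≤ k) (hg : ∀ j < k, KickBound S (Λ (j + 1)) (g (j + 1)))
    {a a' : ℝ → ℝ} {A A' : ℝ} (ha : ∀ x, HasDerivAt a (a' x) x) (haA : ∀ x, |a x| ≤ A)
    (haA' : ∀ x, |a' x| ≤ A') (hap : ∀ x, a (x + 1) = a x)
    {Ψ h Ψ₂ : ℝ → ℝ → ℝ} (hΨ : IsPeriodicPrimitive Ψ h Ψ₂) {P Q : ℝ} (hP : ∀ s t, |Ψ s t| ≤ P)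
    (hQ : ∀ s t, |Ψ₂ s t| ≤ Q) :
    |∫ x in (0 : ℝ)..1, a x * orbitCutoff g Λ k y x *
        h (liftOrbit g y x (k + 1)) (liftOrbit g y x k)| ≤
      P * (A' / ∏ j ∈ Finset.range k, (Λ (j + 1) / 2) + A * (4 * c + 8) * S) +
        Q * A * (2 / Λ k) := by
  obtain ⟨k, rfl⟩ : ∃ l, k = l + 1 := ⟨k - 1, by omega⟩
  have hS : 0 ≤ S := (hg 0 (by omega)).nonneg
  have hc0 : 0 ≤ c := (abs_nonneg _).trans (hc 0)
  have hA : 0 ≤ A := (abs_nonneg _).trans (haA 0)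
  have hA' : 0 ≤ A' := (abs_nonneg _).trans (haA' 0)
  have hP0 : 0 ≤ P := (abs_nonneg _).trans (hP 0 0)
  have hQ0 : 0 ≤ Q := (abs_nonneg _).trans (hQ 0 0)
  have hΛpos : ∀ j < k + 1, 0 < Λ (j + 1) := fun j hj => by linarith [(hg j hj).threshold]
  set U := ∏ j ∈ Finset.range (k + 1), (Λ (j + 1) / 2) with hU
  have hUpos : 0 < U := Finset.prod_pos fun j hj => by
    have := hΛpos j (Finset.mem_range.1 hj); positivity
  set B := P * (A' / U + A * (4 * c + 8) * S) + Q * A * (2 / Λ (k + 1)) with hB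
  have hB0 : 0 ≤ B := by have := hΛpos k (by omega); positivity
  set X := liftOrbit g y with hXdef
  set u := orbitSlope g y with hudef
  set χ := orbitCutoff g Λ (k + 1) y with hχ
  have hX := fun x => hasDerivAt_liftOrbit (y := y) hg x
  set W : ℝ → ℝ := fun x => a x * χ x * Ψ (X x (k + 2)) (X x (k + 1)) / u x (k + 2) with hW
  have hWd : ∀ x, ∃ R, HasDerivAt W (a x * χ x * h (X x (k + 2)) (X x (k + 1)) + R) x ∧
      |R| ≤ B := by
    intro x
    by_cases hx : ∃ j < k + 1, |deriv (g (j + 1)) (X x (j + 1))| < Λ (j + 1)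
    · have h0 := orbitCutoff_eventually_eq_zero hg hx
      refine ⟨0, ?_, by simpa using hB0⟩
      have hWz : W =ᶠ[nhds x] fun _ => 0 := by
        filter_upwards [h0] with z hz
        simp [hW, hχ, hz]
      have hz : χ x = 0 := h0.self_of_nhds
      rw [hz]
      simpa using (hasDerivAt_const x (0 : ℝ)).congr_of_eventuallyEq hWz
    · push Not at hx
      obtain ⟨D, hD, hDle⟩ := hasDerivAt_orbitCutoff hc hg hx
      rw [abs_of_nonneg hS] at hDle
      obtain ⟨hgr, hmono, hprod⟩ := orbitSlope_growth (fun j hj => (hg j hj).threshold) hx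
      have hbend := (orbitBend_le hS hg hx).2
      have hu' := (hasDerivAt_orbitSlope (y := y) hg x).2
      have hupos : 0 < |u x (k + 2)| := hUpos.trans_le hprod
      have hune : u x (k + 2) ≠ 0 := abs_pos.1 hupos
      have hΨX : HasDerivAt (fun x => Ψ (X x (k + 2)) (X x (k + 1)))
          (h (X x (k + 2)) (X x (k + 1)) * u x (k + 2) +
            Ψ₂ (X x (k + 2)) (X x (k + 1)) * u x (k + 1)) x := by
        have := (hΨ.hasFDerivAt (X x (k + 2)) (X x (k + 1))).comp_hasDerivAt x
          ((hX x).2.prodMk (hX x).1)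
        refine HasDerivAt.congr_deriv (f := fun x => Ψ (X x (k + 2)) (X x (k + 1))) this ?_
        simp [hudef]
      set v := orbitBend g y x (k + 2) with hv
      set w := u x (k + 2) with hwdef
      set w' := u x (k + 1) with hw'def
      set ψ := Ψ (X x (k + 2)) (X x (k + 1)) with hψ
      set ψ₂ := Ψ₂ (X x (k + 2)) (X x (k + 1)) with hψ₂
      have hWx := (((ha x).mul hD).mul hΨX).div hu' hune
      refine ⟨a' x * χ x * ψ / w + a x * D * ψ / w - a x * χ x * ψ * v / w ^ 2
        + a x * χ x * ψ₂ * w' / w, ?_, ?_⟩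
      · refine hWx.congr_deriv ?_
        change (((a' x * χ x + a x * D) * ψ +
          a x * χ x * (h (X x (k + 2)) (X x (k + 1)) * w + ψ₂ * w')) * w -
            a x * χ x * ψ * v) / w ^ 2 = _
        field_simp
        ring
      · have hχ0 : 0 ≤ χ x := orbitCutoff_nonneg x
        have hχ1 : χ x ≤ 1 := orbitCutoff_le_one x
        have hψP : |ψ| ≤ P := hP _ _
        have hψQ : |ψ₂| ≤ Q := hQ _ _
        have hΛk := hΛpos k (by omega)
        have e1 : |a' x * χ x * ψ / w| ≤ A' * 1 * P / U := by
          rw [abs_div, abs_mul, abs_mul, abs_of_nonneg hχ0]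
          have := haA' x
          gcongr
        have e2 : |a x * D * ψ / w| ≤ A * (4 * c * S) * P := by
          rw [abs_div, abs_mul, abs_mul, div_le_iff₀ hupos]
          calc |a x| * |D| * |ψ| ≤ A * (4 * c * S * |w|) * P := by
                have := haA x
                gcongr
            _ = _ := by ring
        have e3 : |a x * χ x * ψ * v / w ^ 2| ≤ A * 1 * P * (8 * S) := by
          rw [abs_div, abs_mul, abs_mul, abs_mul, abs_of_nonneg hχ0, abs_of_nonneg (sq_nonneg w),
            div_le_iff₀ (by positivity)]
          calc |a x| * χ x * |ψ| * |v| ≤ A * 1 * P * (8 * S * w ^ 2) := by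
                have := haA x
                gcongr
            _ = _ := by ring
        have e4 : |a x * χ x * ψ₂ * w' / w| ≤ A * 1 * Q * (2 / Λ (k + 1)) := by
          have hw2 : |w'| ≤ 2 / Λ (k + 1) * |w| := by
            have h1 := hgr k (by omega)
            have h2 := hx k (by omega)
            rw [div_mul_eq_mul_div, le_div_iff₀ hΛk]
            have : Λ (k + 1) / 2 * |w'| ≤ |w| := le_trans (by gcongr) h1
            linarith
          rw [abs_div, abs_mul, abs_mul, abs_mul, abs_of_nonneg hχ0, div_le_iff₀ hupos]
          calc |a x| * χ x * |ψ₂| * |w'| ≤ A * 1 * Q * (2 / Λ (k + 1) * |w|) := by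
                have := haA x
                gcongr
            _ = _ := by ring
        calc _ ≤ |a' x * χ x * ψ / w| + |a x * D * ψ / w| + |a x * χ x * ψ * v / w ^ 2|
              + |a x * χ x * ψ₂ * w' / w| :=
              (abs_add_le _ _).trans (add_le_add ((abs_sub _ _).trans
                (add_le_add (abs_add_le _ _) le_rfl)) le_rfl)
          _ ≤ A' * 1 * P / U + A * (4 * c * S) * P + A * 1 * P * (8 * S)
              + A * 1 * Q * (2 / Λ (k + 1)) := by gcongr
          _ = B := by rw [hB]; ring
  choose R hR hRB using hWd
  have hcX : ∀ l ≤ k + 1, Continuous fun x => X x (l + 1) := fun l hl =>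
    continuous_liftOrbit fun j hj => hg j (by omega)
  have hcont : Continuous fun x => a x * χ x * h (X x (k + 2)) (X x (k + 1)) := by
    refine ((continuous_iff_continuousAt.2 fun x => (ha x).continuousAt).mul
      (continuous_orbitCutoff hg)).mul ?_
    exact hΨ.continuous.comp ((hcX (k + 1) le_rfl).prodMk (hcX k (by omega)))
  have hZ : ∀ x, HasDerivAt
      (fun x => W x - ∫ z in (0 : ℝ)..x, a z * χ z * h (X z (k + 2)) (X z (k + 1))) (R x) x := by
    intro x
    refine ((hR x).sub (hcont.integral_hasStrictDerivAt 0 x).hasDerivAt).congr_deriv ?_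
    ring
  have hmv := Convex.norm_image_sub_le_of_norm_hasDerivWithin_le (s := Set.univ) (C := B)
    (fun x _ => (hZ x).hasDerivWithinAt) (fun x _ => hRB x) convex_univ (Set.mem_univ (0 : ℝ))
    (Set.mem_univ (1 : ℝ))
  have hW01 : W 1 = W 0 := by
    have hl : ∀ j < k + 1, IsCircleLift (g (j + 1)) := fun j hj => (hg j hj).lift
    have e1 := coe_liftOrbit_add_one (y := y) hl 0
    have e2 := (orbitSlope_add_one (y := y) hl 0).2
    have e3 := orbitCutoff_add_one (Λ := Λ) (y := y) hl 0
    have e4 := hap 0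
    rw [zero_add] at e1 e2 e3 e4
    simp only [hW, hχ, hXdef, hudef]
    rw [e2, e3, e4, hΨ.periodic _ _ _ _ e1.1 e1.2]
  simp only [intervalIntegral.integral_same, hW01] at hmv
  simpa [Real.norm_eq_abs] using hmv

end

/-! ### Averaging a function on the torus in one of the variables -/

theorem hasDerivAt_integral_comp_add {q : ℝ → ℝ} (hq : Continuous q) (δ t : ℝ) :
    HasDerivAt (fun t => ∫ r in (0 : ℝ)..δ, q (t + r)) (q (t + δ) - q t) t := by
  have hfun : (fun t => ∫ r in (0 : ℝ)..δ, q (t + r)) =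
      fun t => (∫ r in (0 : ℝ)..(t + δ), q r) - ∫ r in (0 : ℝ)..t, q r := by
    ext t
    rw [intervalIntegral.integral_comp_add_left, add_zero,
      intervalIntegral.integral_interval_sub_left] <;> exact hq.intervalIntegrable _ _
  rw [hfun]
  have h1 := (hq.integral_hasStrictDerivAt 0 (t + δ)).hasDerivAt
  have h2 := (hq.integral_hasStrictDerivAt 0 t).hasDerivAt
  exact (h1.comp_add_const t δ).sub h2

/-- The mean of a continuous function over `[0, δ]` is within `C` of each number that is within `C`
of all its values. -/
theorem abs_mean_sub_le {q : ℝ → ℝ} (hq : Continuous q) {δ C v : ℝ} (hδ : 0 < δ)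
    (h : ∀ r, 0 ≤ r → r ≤ δ → |q r - v| ≤ C) : |δ⁻¹ * (∫ r in (0 : ℝ)..δ, q r) - v| ≤ C := by
  have h1 : δ⁻¹ * (∫ r in (0 : ℝ)..δ, q r) - v = δ⁻¹ * ∫ r in (0 : ℝ)..δ, (q r - v) := by
    rw [intervalIntegral.integral_sub (hq.intervalIntegrable _ _) (by simp)]
    simp
    field_simp
  have h2 : ‖∫ r in (0 : ℝ)..δ, (q r - v)‖ ≤ C * |δ - 0| := by
    refine intervalIntegral.norm_integral_le_of_norm_le_const fun r hr => ?_
    rw [Set.uIoc_of_le hδ.le] at hr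
    exact h r hr.1.le hr.2
  rw [Real.norm_eq_abs, sub_zero, abs_of_pos hδ] at h2
  rw [h1, abs_mul, abs_of_pos (inv_pos.2 hδ), inv_mul_le_iff₀ hδ]
  linarith

/-- The average of `φ` over horizontal segments of length `δ`. -/
noncomputable def avgFst (δ : ℝ) (φ : Torus2 → ℝ) (p : Torus2) : ℝ :=
  δ⁻¹ * ∫ r in (0 : ℝ)..δ, φ (p.1 + (r : UnitAddCircle), p.2)

/-- The average of `H` over vertical segments of length `ε`. -/
noncomputable def avgSnd (ε : ℝ) (H : Torus2 → ℝ) (p : Torus2) : ℝ :=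
  ε⁻¹ * ∫ r in (0 : ℝ)..ε, H (p.1, p.2 + (r : UnitAddCircle))

section

variable {φ H : Torus2 → ℝ} {δ ε A : ℝ}

theorem continuous_coe_circle : Continuous fun r : ℝ => (r : UnitAddCircle) :=
  AddCircle.continuous_mk' (1 : ℝ)

theorem continuous_avgFst (hφ : Continuous φ) : Continuous (avgFst δ φ) := by
  refine continuous_const.mul
    (intervalIntegral.continuous_parametric_intervalIntegral_of_continuous' ?_ 0 δ)
  have := continuous_coe_circle
  fun_prop

theorem continuous_avgSnd (hH : Continuous H) : Continuous (avgSnd ε H) := by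
  refine continuous_const.mul
    (intervalIntegral.continuous_parametric_intervalIntegral_of_continuous' ?_ 0 ε)
  have := continuous_coe_circle
  fun_prop

theorem abs_avgFst_sub_le (hφ : Continuous φ) (hδ : 0 < δ) {C v : ℝ} (p : Torus2)
    (h : ∀ r : ℝ, 0 ≤ r → r ≤ δ → |φ (p.1 + (r : UnitAddCircle), p.2) - v| ≤ C) :
    |avgFst δ φ p - v| ≤ C := by
  have := continuous_coe_circle
  exact abs_mean_sub_le (q := fun r => φ (p.1 + (r : UnitAddCircle), p.2)) (by fun_prop) hδ h

theorem abs_avgSnd_sub_le (hH : Continuous H) (hε : 0 < ε) {C v : ℝ} (p : Torus2)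
    (h : ∀ r : ℝ, 0 ≤ r → r ≤ ε → |H (p.1, p.2 + (r : UnitAddCircle)) - v| ≤ C) :
    |avgSnd ε H p - v| ≤ C := by
  have := continuous_coe_circle
  exact abs_mean_sub_le (q := fun r => H (p.1, p.2 + (r : UnitAddCircle))) (by fun_prop) hε h

theorem hasDerivAt_avgFst (hφ : Continuous φ) (x : ℝ) (w : UnitAddCircle) :
    HasDerivAt (fun x : ℝ => avgFst δ φ ((x : UnitAddCircle), w))
      (δ⁻¹ * (φ (((x + δ : ℝ) : UnitAddCircle), w) - φ ((x : UnitAddCircle), w))) x := by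
  have hc := continuous_coe_circle
  have := (hasDerivAt_integral_comp_add (q := fun r : ℝ => φ ((r : UnitAddCircle), w))
    (by fun_prop) δ x).const_mul δ⁻¹
  simpa only [avgFst, AddCircle.coe_add] using this

/-- The primitive of `H` along horizontal lines. -/
noncomputable def primFst (H : Torus2 → ℝ) (s t : ℝ) : ℝ :=
  ∫ r in (0 : ℝ)..s, H ((r : UnitAddCircle), (t : UnitAddCircle))

theorem continuous_primFst (hH : Continuous H) :
    Continuous fun p : ℝ × ℝ => primFst H p.1 p.2 := by
  have hc := continuous_coe_circle
  exact intervalIntegral.continuous_parametric_intervalIntegral_of_continuous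
    (f := fun (p : ℝ × ℝ) r => H ((r : UnitAddCircle), (p.2 : UnitAddCircle))) (by fun_prop)
    continuous_fst

theorem primFst_add_one (hH : Continuous H) (h0 : ∀ w, ∫ z : UnitAddCircle, H (z, w) = 0)
    (s t : ℝ) : primFst H (s + 1) t = primFst H s t := by
  have hc := continuous_coe_circle
  have hq : Continuous fun r : ℝ => H ((r : UnitAddCircle), (t : UnitAddCircle)) := by fun_prop
  have h1 := intervalIntegral.integral_add_adjacent_intervals
    (hq.intervalIntegrable (μ := volume) 0 s) (hq.intervalIntegrable s (s + 1))
  have h2 := UnitAddCircle.intervalIntegral_preimage s fun z => H (z, (t : UnitAddCircle))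
  rw [h2, h0, add_zero] at h1
  exact h1.symm

theorem primFst_eq_of_coe_eq (hH : Continuous H) (h0 : ∀ w, ∫ z : UnitAddCircle, H (z, w) = 0)
    {s t s' t' : ℝ} (hs : (s : UnitAddCircle) = s') (ht : (t : UnitAddCircle) = t') :
    primFst H s t = primFst H s' t' := by
  obtain ⟨k, rfl⟩ := exists_int_of_coe_eq hs
  have hp : Function.Periodic (fun s => primFst H s t) 1 := fun s => primFst_add_one hH h0 s t
  have h1 : primFst H (s' + k) t = primFst H s' t := by simpa using hp.int_mul k s'
  rw [h1, primFst, primFst, ht]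

theorem abs_primFst_le (hH : Continuous H) (h0 : ∀ w, ∫ z : UnitAddCircle, H (z, w) = 0)
    (hA : ∀ p, |H p| ≤ A) (s t : ℝ) : |primFst H s t| ≤ A := by
  have hA0 : 0 ≤ A := (abs_nonneg _).trans (hA 0)
  have h1 : primFst H s t = primFst H (Int.fract s) t :=
    primFst_eq_of_coe_eq hH h0 (by
      conv_lhs => rw [← Int.fract_add_floor s, coe_add_int]) rfl
  have h2 : ‖primFst H (Int.fract s) t‖ ≤ A * |Int.fract s - 0| :=
    intervalIntegral.norm_integral_le_of_norm_le_const fun r _ => hA _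
  rw [sub_zero, abs_of_nonneg (Int.fract_nonneg s)] at h2
  rw [h1]
  exact h2.trans (mul_le_of_le_one_right hA0 (Int.fract_lt_one s).le)

/-- The horizontal primitive of the vertical average of `H`, which is continuously differentiable
when `H` is merely continuous. -/
noncomputable def avgPrim (ε : ℝ) (H : Torus2 → ℝ) (s t : ℝ) : ℝ :=
  ε⁻¹ * ∫ r in (0 : ℝ)..ε, primFst H s (t + r)

theorem avgPrim_eq (hH : Continuous H) (s t : ℝ) :
    avgPrim ε H s t =
      ∫ r in (0 : ℝ)..s, avgSnd ε H ((r : UnitAddCircle), (t : UnitAddCircle)) := by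
  have hc := continuous_coe_circle
  simp only [avgPrim, avgSnd, primFst]
  rw [intervalIntegral.integral_const_mul, intervalIntegral_intervalIntegral_swap]
  · simp only [AddCircle.coe_add]
  · have : Continuous (Function.uncurry fun r r' : ℝ =>
        H ((r' : UnitAddCircle), ((t + r : ℝ) : UnitAddCircle))) := by fun_prop
    exact this.continuousOn.integrableOn_compact (isCompact_uIcc.prod isCompact_uIcc) |>.mono_set
      (Set.prod_mono Set.uIoc_subset_uIcc Set.uIoc_subset_uIcc)

theorem abs_avgPrim_le (hH : Continuous H) (h0 : ∀ w, ∫ z : UnitAddCircle, H (z, w) = 0)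
    (hA : ∀ p, |H p| ≤ A) (hε : 0 < ε) (s t : ℝ) : |avgPrim ε H s t| ≤ A := by
  have hc := continuous_primFst hH
  have := abs_mean_sub_le (q := fun r => primFst H s (t + r)) (v := 0) (C := A)
    (hc.comp (f := fun r => (s, t + r)) (by fun_prop)) hε fun r _ _ => by
      simpa using abs_primFst_le hH h0 hA s (t + r)
  simpa [avgPrim] using this

theorem isPeriodicPrimitive_avgPrim (hH : Continuous H)
    (h0 : ∀ w, ∫ z : UnitAddCircle, H (z, w) = 0) :
    IsPeriodicPrimitive (avgPrim ε H)
      (fun s t => avgSnd ε H ((s : UnitAddCircle), (t : UnitAddCircle)))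
      (fun s t => ε⁻¹ * (primFst H s (t + ε) - primFst H s t)) := by
  have hcc := continuous_coe_circle
  have hJ := continuous_primFst hH
  have hh : Continuous fun p : ℝ × ℝ => avgSnd ε H ((p.1 : UnitAddCircle), (p.2 : UnitAddCircle)) :=
    (continuous_avgSnd hH).comp (by fun_prop)
  have h2 : Continuous fun p : ℝ × ℝ => ε⁻¹ * (primFst H p.1 (p.2 + ε) - primFst H p.1 p.2) :=
    continuous_const.mul ((hJ.comp (f := fun p : ℝ × ℝ => (p.1, p.2 + ε)) (by fun_prop)).sub hJ)
  refine ⟨fun s t => ?_, hh, fun s t s' t' hs ht => ?_⟩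
  · have key := hasStrictFDerivAt_uncurry_coprod (𝕜 := ℝ) (u := (s, t)) (f := avgPrim ε H)
      (f₁ := fun s t => avgSnd ε H ((s : UnitAddCircle), (t : UnitAddCircle)) •
        ContinuousLinearMap.id ℝ ℝ)
      (f₂ := fun s t => (ε⁻¹ * (primFst H s (t + ε) - primFst H s t)) •
        ContinuousLinearMap.id ℝ ℝ)
      (Filter.Eventually.of_forall fun p => ?_) (Filter.Eventually.of_forall fun p => ?_)
      (hh.smul continuous_const).continuousAt (h2.smul continuous_const).continuousAt
    · refine key.hasFDerivAt.congr_fderiv ?_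
      ext <;> simp [Function.HasUncurry.uncurry]
    · have hd : HasDerivAt (fun x => avgPrim ε H x p.2)
          (avgSnd ε H ((p.1 : UnitAddCircle), (p.2 : UnitAddCircle))) p.1 := by
        simp only [avgPrim_eq hH]
        have : Continuous fun r : ℝ => avgSnd ε H ((r : UnitAddCircle), (p.2 : UnitAddCircle)) :=
          hh.comp (f := fun r => (r, p.2)) (by fun_prop)
        exact (this.integral_hasStrictDerivAt 0 p.1).hasDerivAt
      refine hd.hasFDerivAt.congr_fderiv ?_
      ext; simp [Function.HasUncurry.uncurry]
    · have hd : HasDerivAt (fun x => avgPrim ε H p.1 x)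
          (ε⁻¹ * (primFst H p.1 (p.2 + ε) - primFst H p.1 p.2)) p.2 :=
        (hasDerivAt_integral_comp_add (q := fun t => primFst H p.1 t)
          (hJ.comp (f := fun t => (p.1, t)) (by fun_prop)) ε p.2).const_mul ε⁻¹
      refine hd.hasFDerivAt.congr_fderiv ?_
      ext; simp [Function.HasUncurry.uncurry]
  · simp only [avgPrim]
    congr 2 with r
    exact primFst_eq_of_coe_eq hH h0 hs (by rw [AddCircle.coe_add, ht, AddCircle.coe_add])

end

/-! ### Correlations with a function of mean zero on horizontal lines -/

section

variable {g : ℕ → ℝ → ℝ} {k : ℕ} {S : ℝ} {Λ : ℕ → ℝ}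

/-- The cutoff `orbitCutoff` as a function on the torus. -/
noncomputable def torusCutoff (g : ℕ → ℝ → ℝ) (Λ : ℕ → ℝ) (k : ℕ) (p : Torus2) : ℝ :=
  ∏ j ∈ Finset.range k,
    slopeCutoff (deriv (g (j + 1)) (circleRep (kickComp g j p).1) / Λ (j + 1))

theorem torusCutoff_coe (hg : ∀ j < k, IsCircleLift (g (j + 1))) (x y : ℝ) :
    torusCutoff g Λ k ((x : UnitAddCircle), (y : UnitAddCircle)) = orbitCutoff g Λ k y x := by
  refine Finset.prod_congr rfl fun j hj => ?_
  have hj := Finset.mem_range.1 hj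
  rw [kickComp_coe (fun i hi => hg i (hi.trans hj)), (hg j hj).deriv_eq_of_coe_eq (coe_circleRep _)]

theorem torusCutoff_nonneg (p : Torus2) : 0 ≤ torusCutoff g Λ k p :=
  Finset.prod_nonneg fun _ _ => slopeCutoff_nonneg _

theorem torusCutoff_le_one (p : Torus2) : torusCutoff g Λ k p ≤ 1 :=
  Finset.prod_le_one (fun _ _ => slopeCutoff_nonneg _) fun _ _ => slopeCutoff_le_one _

theorem measurePreserving_kickComp_of_kickBound
    (hg : ∀ j < k, KickBound S (Λ (j + 1)) (g (j + 1))) : MeasurePreserving (kickComp g k) := by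
  refine measurePreserving_kickComp fun j h1 h2 => ?_
  obtain ⟨i, rfl⟩ : ∃ i, j = i + 1 := ⟨j - 1, by omega⟩
  exact (hg i (by omega)).contDiff.continuous.measurable

theorem measurable_torusCutoff (hg : ∀ j < k, KickBound S (Λ (j + 1)) (g (j + 1))) :
    Measurable (torusCutoff g Λ k) := by
  refine Finset.measurable_fun_prod _ fun j hj => ?_
  have hj := Finset.mem_range.1 hj
  refine contDiff_slopeCutoff.continuous.measurable.comp (Measurable.div_const ?_ _)
  refine (hg j hj).contDiff_deriv.continuous.measurable.comp (measurable_circleRep.comp ?_)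
  exact measurable_fst.comp
    (measurePreserving_kickComp_of_kickBound fun i hi => hg i (hi.trans hj)).measurable

/-- Up to the sum of the measures of the critical strips, the cutoff is `1`: the maps preserve
Lebesgue measure, so the orbit point at each time is uniformly distributed. -/
theorem integral_one_sub_torusCutoff_le (hg : ∀ j < k, KickBound S (Λ (j + 1)) (g (j + 1))) :
    ∫ p : Torus2, (1 - torusCutoff g Λ k p) ≤ ∑ j ∈ Finset.range k,
      volume.real {z : UnitAddCircle | |deriv (g (j + 1)) (circleRep z)| < 2 * Λ (j + 1)} := by
  set E : ℕ → Set UnitAddCircle :=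
    fun j => {z | |deriv (g (j + 1)) (circleRep z)| < 2 * Λ (j + 1)} with hE
  set F : ℕ → Set Torus2 := fun j => (fun p => (kickComp g j p).1) ⁻¹' E j with hF
  have hEm : ∀ j < k, MeasurableSet (E j) := fun j hj =>
    measurableSet_lt (((hg j hj).contDiff_deriv.continuous.measurable.comp
      measurable_circleRep).abs) measurable_const
  have hmp : ∀ j < k, MeasurePreserving (fun p => (kickComp g j p).1)
      (volume : Measure Torus2) volume := fun j hj =>
    measurePreserving_fst.comp
      (measurePreserving_kickComp_of_kickBound fun i hi => hg i (hi.trans hj))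
  have hFm : ∀ j < k, MeasurableSet (F j) := fun j hj => (hmp j hj).measurable (hEm j hj)
  have hFi : ∀ j ∈ Finset.range k, Integrable ((F j).indicator fun _ => (1 : ℝ)) := fun j hj =>
    (integrable_const 1).indicator (hFm j (Finset.mem_range.1 hj))
  have hpt : ∀ p, 1 - torusCutoff g Λ k p ≤
      ∑ j ∈ Finset.range k, (F j).indicator (fun _ => (1 : ℝ)) p := by
    intro p
    have hnn : ∀ j ∈ Finset.range k, 0 ≤ (F j).indicator (fun _ => (1 : ℝ)) p :=
      fun j _ => Set.indicator_nonneg (fun _ _ => zero_le_one) p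
    by_cases h : ∃ j < k, p ∈ F j
    · obtain ⟨j, hj, hp⟩ := h
      have h1 := Finset.single_le_sum hnn (Finset.mem_range.2 hj)
      rw [Set.indicator_of_mem hp] at h1
      linarith [torusCutoff_nonneg (g := g) (Λ := Λ) (k := k) p]
    · push Not at h
      have : torusCutoff g Λ k p = 1 := Finset.prod_eq_one fun j hj => by
        have hj := Finset.mem_range.1 hj
        have hΛ : 0 < Λ (j + 1) := by linarith [(hg j hj).threshold]
        have h2 : ¬ |deriv (g (j + 1)) (circleRep (kickComp g j p).1)| < 2 * Λ (j + 1) := h j hj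
        refine slopeCutoff_eq_one ?_
        rw [abs_div, abs_of_pos hΛ, le_div_iff₀ hΛ]
        exact not_lt.1 h2
      rw [this, sub_self]
      exact Finset.sum_nonneg hnn
  have hci : Integrable fun p : Torus2 => 1 - torusCutoff g Λ k p :=
    Integrable.of_bound (measurable_const.sub (measurable_torusCutoff hg)).aestronglyMeasurable 1
      (Filter.Eventually.of_forall fun p => by
        rw [Real.norm_eq_abs, abs_of_nonneg (sub_nonneg.2 (torusCutoff_le_one p))]
        linarith [torusCutoff_nonneg (g := g) (Λ := Λ) (k := k) p])
  calc ∫ p : Torus2, (1 - torusCutoff g Λ k p)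
      ≤ ∫ p : Torus2, ∑ j ∈ Finset.range k, (F j).indicator (fun _ => (1 : ℝ)) p :=
        integral_mono hci (integrable_finsetSum _ hFi) hpt
    _ = ∑ j ∈ Finset.range k, ∫ p : Torus2, (F j).indicator (fun _ => (1 : ℝ)) p :=
        integral_finsetSum _ hFi
    _ = _ := by
        refine Finset.sum_congr rfl fun j hj => ?_
        have hj := Finset.mem_range.1 hj
        rw [integral_indicator_const _ (hFm j hj), smul_eq_mul, mul_one, Measure.real,
          (hmp j hj).measure_preimage (hEm j hj).nullMeasurableSet, Measure.real]

theorem abs_integral_le_of_forall_abs_le {X : Type*} [MeasurableSpace X] {μ : Measure X}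
    [IsProbabilityMeasure μ] {q : X → ℝ} {D : ℝ} (hq : ∀ x, |q x| ≤ D) : |∫ x, q x ∂μ| ≤ D := by
  have h := norm_integral_le_of_norm_le_const (μ := μ) (f := q) (Filter.Eventually.of_forall hq)
  rwa [probReal_univ, mul_one] at h

/-- The correlation of `φ` with `H ∘ F^k` for `H` of mean zero on horizontal lines. The terms of the
bound come from averaging `φ`, from averaging `H`, from the cutoff, and from the integration by
parts. -/
theorem abs_integral_mul_kickComp_le {c : ℝ} (hc : ∀ t, |deriv slopeCutoff t| ≤ c)
    (hk : 1 ≤ k) (hg : ∀ j < k, KickBound S (Λ (j + 1)) (g (j + 1)))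
    {φ H : Torus2 → ℝ} (hφ : Continuous φ) (hH : Continuous H) {A B e₁ e₂ β δ ε : ℝ}
    (hφA : ∀ p, |φ p| ≤ A) (hHB : ∀ p, |H p| ≤ B) (hδ : 0 < δ) (hε : 0 < ε)
    (hφe : ∀ (p : Torus2) (r : ℝ), 0 ≤ r → r ≤ δ →
      |φ (p.1 + (r : UnitAddCircle), p.2) - φ p| ≤ A * e₁)
    (hHe : ∀ (p : Torus2) (r : ℝ), 0 ≤ r → r ≤ ε →
      |H (p.1, p.2 + (r : UnitAddCircle)) - H p| ≤ B * e₂)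
    (h0 : ∀ w, ∫ z : UnitAddCircle, H (z, w) = 0)
    (hβ : ∑ j ∈ Finset.range k, volume.real
      {z : UnitAddCircle | |deriv (g (j + 1)) (circleRep z)| < 2 * Λ (j + 1)} ≤ β) :
    |∫ p : Torus2, φ p * H (kickComp g k p)| ≤
      A * B * (e₁ + e₂ + β + 2 / (δ * ∏ j ∈ Finset.range k, (Λ (j + 1) / 2))
        + (4 * c + 8) * S + 4 / (ε * Λ k)) := by
  have hA : 0 ≤ A := (abs_nonneg _).trans (hφA 0)
  have hB : 0 ≤ B := (abs_nonneg _).trans (hHB 0)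
  have hlift : ∀ j < k, IsCircleLift (g (j + 1)) := fun j hj => (hg j hj).lift
  have hG := (measurePreserving_kickComp_of_kickBound hg).measurable
  have hχm := measurable_torusCutoff hg
  have hφδ := continuous_avgFst (δ := δ) hφ
  have hHε := continuous_avgSnd (ε := ε) hH
  have hφδA : ∀ p, |avgFst δ φ p| ≤ A := fun p => by
    simpa using abs_avgFst_sub_le (v := 0) hφ hδ p fun r _ _ => by simpa using hφA _
  have hHεB : ∀ p, |avgSnd ε H p| ≤ B := fun p => by
    simpa using abs_avgSnd_sub_le (v := 0) hH hε p fun r _ _ => by simpa using hHB _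
  have hφδe : ∀ p, |avgFst δ φ p - φ p| ≤ A * e₁ := fun p => abs_avgFst_sub_le hφ hδ p (hφe p)
  have hHεe : ∀ p, |avgSnd ε H p - H p| ≤ B * e₂ := fun p => abs_avgSnd_sub_le hH hε p (hHe p)
  set χ := torusCutoff g Λ k with hχ
  have hχ0 : ∀ p, 0 ≤ χ p := torusCutoff_nonneg
  have hχ1 : ∀ p, χ p ≤ 1 := torusCutoff_le_one
  set M : Torus2 → ℝ := fun p => avgFst δ φ p * χ p * avgSnd ε H (kickComp g k p) with hM
  have hMi : Integrable M := by
    refine Integrable.of_bound ((hφδ.measurable.mul hχm).mul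
      (hHε.measurable.comp hG)).aestronglyMeasurable (A * 1 * B)
      (Filter.Eventually.of_forall fun p => ?_)
    rw [Real.norm_eq_abs, abs_mul, abs_mul, abs_of_nonneg (hχ0 p)]
    gcongr
    exacts [hχ0 p, hφδA p, hχ1 p, hHεB _]
  have hNi : Integrable fun p => φ p * H (kickComp g k p) := by
    refine Integrable.of_bound (hφ.measurable.mul (hH.measurable.comp hG)).aestronglyMeasurable
      (A * B) (Filter.Eventually.of_forall fun p => ?_)
    rw [Real.norm_eq_abs, abs_mul]
    gcongr
    exacts [hφA p, hHB _]
  have hci : Integrable fun p : Torus2 => 1 - χ p :=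
    Integrable.of_bound (measurable_const.sub hχm).aestronglyMeasurable 1
      (Filter.Eventually.of_forall fun p => by
        rw [Real.norm_eq_abs, abs_of_nonneg (sub_nonneg.2 (hχ1 p))]
        linarith [hχ0 p])
  have hdiff : |(∫ p : Torus2, φ p * H (kickComp g k p)) - ∫ p, M p| ≤
      A * B * (e₁ + e₂ + β) := by
    rw [← integral_sub hNi hMi]
    have hpt : ∀ p, ‖φ p * H (kickComp g k p) - M p‖ ≤
        A * B * (e₁ + e₂) + A * B * (1 - χ p) := by
      intro p
      set q := kickComp g k p
      have hsplit : φ p * H q - M p = -((avgFst δ φ p - φ p) * H q) +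
          avgFst δ φ p * (1 - χ p) * H q - avgFst δ φ p * χ p * (avgSnd ε H q - H q) := by
        rw [hM]; ring
      have h1 : |-((avgFst δ φ p - φ p) * H q)| ≤ A * e₁ * B := by
        rw [abs_neg, abs_mul]
        have h4 := hφδe p
        have h5 := (abs_nonneg _).trans h4
        have := hHB q
        gcongr
      have h2 : |avgFst δ φ p * (1 - χ p) * H q| ≤ A * (1 - χ p) * B := by
        have h3 : 0 ≤ 1 - χ p := sub_nonneg.2 (hχ1 p)
        rw [abs_mul, abs_mul, abs_of_nonneg h3]
        have := hφδA p
        have := hHB q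
        gcongr
      have h3 : |avgFst δ φ p * χ p * (avgSnd ε H q - H q)| ≤ A * 1 * (B * e₂) := by
        rw [abs_mul, abs_mul, abs_of_nonneg (hχ0 p)]
        have := hφδA p
        have := hHεe q
        have := hχ1 p
        have := hχ0 p
        gcongr
      rw [hsplit, Real.norm_eq_abs]
      refine (abs_sub _ _).trans ((add_le_add ((abs_add_le _ _).trans (add_le_add h1 h2)) h3).trans
        (le_of_eq ?_))
      ring
    refine (norm_integral_le_of_norm_le
      ((integrable_const _).add (hci.const_mul _)) (Filter.Eventually.of_forall hpt)).trans ?_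
    simp only [Pi.add_apply]
    rw [integral_add (integrable_const _) (hci.const_mul _),
      integral_const_mul (A * B) fun p => 1 - χ p]
    have h1 := (integral_one_sub_torusCutoff_le hg).trans hβ
    have h2 : A * B * ∫ p : Torus2, (1 - χ p) ≤ A * B * β := by gcongr
    simp only [integral_const, probReal_univ, one_smul]
    linarith
  have hmain : |∫ p, M p| ≤ B * (2 * A / δ / ∏ j ∈ Finset.range k, (Λ (j + 1) / 2)
      + A * (4 * c + 8) * S) + 2 * B / ε * A * (2 / Λ k) := by
    have hFub : ∫ p, M p = ∫ w : UnitAddCircle, ∫ z : UnitAddCircle, M (z, w) :=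
      integral_prod_symm M hMi
    rw [hFub]
    set D := B * (2 * A / δ / ∏ j ∈ Finset.range k, (Λ (j + 1) / 2)
      + A * (4 * c + 8) * S) + 2 * B / ε * A * (2 / Λ k) with hD
    refine abs_integral_le_of_forall_abs_le fun w => ?_
    obtain ⟨y, rfl⟩ : ∃ y : ℝ, (y : UnitAddCircle) = w := ⟨circleRep w, coe_circleRep w⟩
    rw [← UnitAddCircle.intervalIntegral_preimage 0, zero_add]
    have hline : ∀ x : ℝ, M ((x : UnitAddCircle), (y : UnitAddCircle)) =
        avgFst δ φ ((x : UnitAddCircle), (y : UnitAddCircle)) * orbitCutoff g Λ k y x *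
          avgSnd ε H ((liftOrbit g y x (k + 1) : UnitAddCircle),
            (liftOrbit g y x k : UnitAddCircle)) := fun x => by
      simp only [hM, hχ]
      rw [torusCutoff_coe hlift, kickComp_coe hlift]
    simp only [hline]
    refine abs_integral_orbit_le hc hk hg
      (a := fun x => avgFst δ φ ((x : UnitAddCircle), (y : UnitAddCircle)))
      (fun x => hasDerivAt_avgFst hφ x _) (fun x => hφδA _) (fun x => ?_) (fun x => ?_)
      (isPeriodicPrimitive_avgPrim (ε := ε) hH h0) (fun s t => abs_avgPrim_le hH h0 hHB hε s t)
      (fun s t => ?_)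
    · rw [abs_mul, abs_of_pos (inv_pos.2 hδ), inv_mul_eq_div]
      gcongr
      refine (abs_sub _ _).trans ?_
      have h1 := hφA (((x + δ : ℝ) : UnitAddCircle), (y : UnitAddCircle))
      have h2 := hφA ((x : UnitAddCircle), (y : UnitAddCircle))
      linarith
    · rw [show ((x + 1 : ℝ) : UnitAddCircle) = x by simp]
    · rw [abs_mul, abs_of_pos (inv_pos.2 hε), inv_mul_eq_div]
      gcongr
      refine (abs_sub _ _).trans ?_
      have h1 := abs_primFst_le hH h0 hHB s (t + ε)
      have h2 := abs_primFst_le hH h0 hHB s t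
      linarith
  have htri := abs_sub_abs_le_abs_sub (∫ p : Torus2, φ p * H (kickComp g k p)) (∫ p, M p)
  have hfin : B * (2 * A / δ / ∏ j ∈ Finset.range k, (Λ (j + 1) / 2)
      + A * (4 * c + 8) * S) + 2 * B / ε * A * (2 / Λ k) =
      A * B * (2 / (δ * ∏ j ∈ Finset.range k, (Λ (j + 1) / 2))
        + (4 * c + 8) * S + 4 / (ε * Λ k)) := by
    simp only [div_eq_mul_inv, mul_inv]
    ring
  rw [hfin] at hmain
  linarith

end

/-! ### Decay of correlations -/

section

variable {K₀ K₁ ℓ : ℝ} {M₀ : ℕ}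

namespace AdmissibleKick

variable {f : ℝ → ℝ}

theorem isCircleLift (h : AdmissibleKick K₀ K₁ M₀ ℓ f) : IsCircleLift f := h.degree

theorem differentiable (h : AdmissibleKick K₀ K₁ M₀ ℓ f) : Differentiable ℝ f :=
  h.contDiff.differentiable (by norm_num)

theorem abs_deriv_le (h : AdmissibleKick K₀ K₁ M₀ ℓ f) (x : ℝ) : |deriv f x| ≤ K₀ * ℓ := by
  linarith [h.upper x x, abs_nonneg (deriv (deriv f) x)]

end AdmissibleKick

/-- With `σ = (1 - η) / 2 < 1 / 4`, the threshold `ℓ ^ (1 - σ)` is at least `ℓ ^ (3 / 4)`; half of it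
is an expansion by `√ℓ` once `ℓ ^ (1 / 4) ≥ 2`. -/
theorem two_mul_sqrt_le_rpow {σ : ℝ} (hσ : σ ≤ 1 / 4) (hℓ : 256 ≤ ℓ) :
    2 * √ℓ ≤ ℓ ^ (1 - σ) := by
  have hℓ0 : 0 < ℓ := by linarith
  have h4 : (2 : ℝ) ≤ ℓ ^ (1 / 4 : ℝ) := by
    have : (16 : ℝ) ^ (1 / 4 : ℝ) = 2 := by
      rw [show (16 : ℝ) = 2 ^ (4 : ℝ) by norm_num, ← Real.rpow_mul (by norm_num)]; norm_num
    rw [← this]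
    exact Real.rpow_le_rpow (by norm_num) (by linarith) (by norm_num)
  calc 2 * √ℓ ≤ ℓ ^ (1 / 4 : ℝ) * ℓ ^ (1 / 2 : ℝ) := by rw [Real.sqrt_eq_rpow]; gcongr
    _ = ℓ ^ (3 / 4 : ℝ) := by rw [← Real.rpow_add hℓ0]; norm_num
    _ ≤ ℓ ^ (1 - σ) := Real.rpow_le_rpow_of_exponent_le (by linarith) (by linarith)

/-- The ratio of `|f''| ≤ K₀ ℓ` to the square of the threshold is `K₀ ℓ ^ (2 σ - 1)`, which is at most
`K₀ ℓ ^ (-σ)`. -/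
theorem AdmissibleKick.kickBound {f : ℝ → ℝ} (h : AdmissibleKick K₀ K₁ M₀ ℓ f) (hK₀ : 0 < K₀)
    {σ T : ℝ} (hσ : σ ≤ 1 / 4) (hℓ : 256 ≤ ℓ) (hT : ℓ ^ (-σ) ≤ T) :
    KickBound (K₀ * T) (ℓ ^ (1 - σ)) f := by
  have hℓ0 : 0 < ℓ := by linarith
  refine ⟨h.contDiff.of_le (by norm_num), h.degree, ?_, fun x => ?_⟩
  · have h1 : (16 : ℝ) ≤ √ℓ := Real.le_sqrt_of_sq_le (by linarith)
    linarith [two_mul_sqrt_le_rpow hσ hℓ]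
  · have h1 : |deriv (deriv f) x| ≤ K₀ * ℓ := by linarith [h.upper x x, abs_nonneg (deriv f x)]
    have h2 : ℓ ≤ ℓ ^ (-σ) * (ℓ ^ (1 - σ)) ^ 2 := by
      rw [← Real.rpow_natCast, ← Real.rpow_mul hℓ0.le, ← Real.rpow_add hℓ0]
      exact Real.self_le_rpow_of_one_le (by linarith) (by push_cast; linarith)
    calc |deriv (deriv f) x| ≤ K₀ * (ℓ ^ (-σ) * (ℓ ^ (1 - σ)) ^ 2) := h1.trans (by gcongr)
      _ ≤ K₀ * (T * (ℓ ^ (1 - σ)) ^ 2) := by gcongr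
      _ = _ := by ring

variable {L : ℕ → ℝ} {f : ℕ → ℝ → ℝ} {σ α : ℝ} {m k : ℕ}

/-- The growth over the last `k` steps beats the Lipschitz constant of the inverse of the first `m`
steps, as soon as `k > 4 m`: the former is at least `√ℓ ^ k`, the latter at most `ℓ ^ (2 m)`, where
`ℓ` separates the coefficients of the two stretches. -/
theorem prod_mul_sqrt_le_prod (hσ : σ ≤ 1 / 4) (hK₀ : 0 < K₀) (hpos : 0 < L 0) (hL : Monotone L)
    (h256 : 256 ≤ L 1) (hLK : K₀ + 1 ≤ L 1) (hk : 4 * m + 1 ≤ k) :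
    (∏ j ∈ Finset.range m, (K₀ * L (j + 1) + 1)) * √(L (m + 1)) ≤
      ∏ j ∈ Finset.range k, (L (m + (j + 1)) ^ (1 - σ) / 2) := by
  set ℓ := L (m + 1) with hℓ
  have hℓ1 : L 1 ≤ ℓ := hL (by omega)
  have hs : 1 ≤ √ℓ := Real.one_le_sqrt.2 (by linarith)
  have h1 : ∏ j ∈ Finset.range m, (K₀ * L (j + 1) + 1) ≤ (ℓ ^ 2) ^ m := by
    refine (Finset.prod_le_prod (fun j _ => ?_) fun j hj => ?_).trans (le_of_eq
      (by rw [Finset.prod_const, Finset.card_range]))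
    · have : 0 < L (j + 1) := hpos.trans_le (hL (by omega))
      positivity
    · have h3 : L (j + 1) ≤ ℓ := hL (by have := Finset.mem_range.1 hj; omega)
      nlinarith
  have h2 : √ℓ ^ k ≤ ∏ j ∈ Finset.range k, (L (m + (j + 1)) ^ (1 - σ) / 2) := by
    rw [← Finset.card_range k, ← Finset.prod_const, Finset.card_range]
    refine Finset.prod_le_prod (fun j _ => Real.sqrt_nonneg _) fun j _ => ?_
    have h3 : ℓ ≤ L (m + (j + 1)) := hL (by omega)
    have h4 := two_mul_sqrt_le_rpow hσ (ℓ := L (m + (j + 1))) (by linarith)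
    have h5 := Real.sqrt_le_sqrt h3
    linarith
  calc _ ≤ (ℓ ^ 2) ^ m * √ℓ := by gcongr
    _ = √ℓ ^ (4 * m + 1) := by
        rw [pow_succ √ℓ, show 4 * m = 2 * (2 * m) by ring, pow_mul √ℓ, Real.sq_sqrt (by linarith),
          pow_mul ℓ]
    _ ≤ √ℓ ^ k := pow_le_pow_right₀ hs hk
    _ ≤ _ := h2

/-- The tail of the series that measures the critical strips. -/
noncomputable def stripTail (L : ℕ → ℝ) (σ : ℝ) (m : ℕ) : ℝ := ∑' i : ℕ, L (m + i) ^ (-σ)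

theorem sum_le_stripTail (hpos : 0 < L 0) (hL : Monotone L)
    (hsum : Summable fun n : ℕ => L n ^ (-σ)) (k : ℕ) :
    ∑ j ∈ Finset.range k, L (m + (j + 1)) ^ (-σ) ≤ stripTail L σ m := by
  have hnn : ∀ i, 0 ≤ L i ^ (-σ) := fun i => Real.rpow_nonneg (hpos.le.trans (hL (Nat.zero_le i))) _
  have hs : Summable fun i : ℕ => L (m + i) ^ (-σ) := hsum.comp_injective (add_right_injective m)
  refine le_trans ?_ (hs.sum_le_tsum (Finset.range (k + 1)) fun i _ => hnn _)
  rw [Finset.sum_range_succ']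
  linarith [hnn (m + 0)]

theorem rpow_le_stripTail (hpos : 0 < L 0) (hL : Monotone L)
    (hsum : Summable fun n : ℕ => L n ^ (-σ)) (j : ℕ) : L (m + j) ^ (-σ) ≤ stripTail L σ m := by
  have hnn : ∀ i, 0 ≤ L i ^ (-σ) := fun i => Real.rpow_nonneg (hpos.le.trans (hL (Nat.zero_le i))) _
  have hs : Summable fun i : ℕ => L (m + i) ^ (-σ) := hsum.comp_injective (add_right_injective m)
  exact hs.le_tsum j fun i _ => hnn _

/-- Past functions are transported to time `m` by the inverse of the first `m` maps, which is
Lipschitz. The averaging lengths are `ε = T ^ (1 / (α + 2))` in the future and `ε` divided by that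
Lipschitz constant in the past. -/
theorem abs_integral_transport_le {c : ℝ} (hc : ∀ t, |deriv slopeCutoff t| ≤ c)
    (hK₀ : 0 < K₀) (hK₁ : 0 < K₁) (hσ0 : 0 < σ) (hσ : σ ≤ 1 / 4) (hpos : 0 < L 0) (hL : Monotone L)
    (h256 : 256 ≤ L 1) (hLK : K₀ + 1 ≤ L 1) (hsum : Summable fun n : ℕ => L n ^ (-σ))
    (hf : ∀ n : ℕ, 1 ≤ n → AdmissibleKick K₀ K₁ M₀ (L n) (f n))
    (hα : 0 < α) (hα1 : α ≤ 1) (hT1 : stripTail L σ m ≤ 1) (hk : 4 * m + 1 ≤ k)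
    {φ H : Torus2 → ℝ} (hφ : IsHolder α φ) (hH : Continuous H) {B : ℝ} (hHB : ∀ p, |H p| ≤ B)
    (hHe : ∀ (p : Torus2) (r : ℝ), 0 ≤ r →
      |H (p.1, p.2 + (r : UnitAddCircle)) - H p| ≤ B * (2 * r) ^ α)
    (h0 : ∀ w, ∫ z : UnitAddCircle, H (z, w) = 0) :
    |∫ p : Torus2, φ (kickCompInv f m p) * H (kickComp (fun j => f (m + j)) k p)| ≤
      holderNorm α φ * B * ((10 + 4 * M₀ * K₁ + (4 * c + 8) * K₀) *
        stripTail L σ m ^ (α / (α + 2))) := by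
  set T := stripTail L σ m with hT
  have hc0 : 0 ≤ c := (abs_nonneg _).trans (hc 0)
  have hB : 0 ≤ B := (abs_nonneg _).trans (hHB 0)
  have hLpos : ∀ i, 0 < L i := fun i => hpos.trans_le (hL (Nat.zero_le i))
  have hL1 : ∀ i, L 1 ≤ L (m + (i + 1)) := fun i => hL (by omega)
  have hTj : ∀ j, L (m + j) ^ (-σ) ≤ T := rpow_le_stripTail hpos hL hsum
  have hT0 : 0 < T := (Real.rpow_pos_of_pos (hLpos (m + 0)) _).trans_le (hTj 0)
  -- for every coefficient `ℓ` after time `m`, `ℓ ^ (-1/2) ≤ T²`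
  have hsq : ∀ j, 1 ≤ √(L (m + (j + 1))) * T ^ 2 := by
    intro j
    have hl := hLpos (m + (j + 1))
    have h1 : (L (m + (j + 1)) ^ (-σ)) ^ 2 ≤ T ^ 2 := by
      have := hTj (j + 1)
      have := Real.rpow_nonneg hl.le (-σ)
      gcongr
    calc (1 : ℝ) ≤ L (m + (j + 1)) ^ (1 / 2 - 2 * σ) :=
          Real.one_le_rpow (by linarith [hL1 j]) (by linarith)
      _ = √(L (m + (j + 1))) * (L (m + (j + 1)) ^ (-σ)) ^ 2 := by
          rw [← Real.rpow_natCast, ← Real.rpow_mul hl.le, Real.sqrt_eq_rpow, ← Real.rpow_add hl]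
          congr 1; push_cast; ring
      _ ≤ _ := by gcongr
  set τ := T ^ (1 / (α + 2)) with hτ
  have hτ0 : 0 < τ := Real.rpow_pos_of_pos hT0 _
  have hTτ : T ≤ τ := by
    refine Real.self_le_rpow_of_le_one hT0.le hT1 ?_
    rw [div_le_one (by linarith)]; linarith
  set R := T ^ (α / (α + 2)) with hR
  have hTR : T ≤ R := by
    refine Real.self_le_rpow_of_le_one hT0.le hT1 ?_
    rw [div_le_one (by linarith)]; linarith
  have hτR : (2 * τ) ^ α ≤ 2 * R := by
    rw [Real.mul_rpow (by norm_num) hτ0.le, hτ, ← Real.rpow_mul hT0.le, one_div_mul_eq_div, ← hR]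
    have : (2 : ℝ) ^ α ≤ 2 ^ (1 : ℝ) := Real.rpow_le_rpow_of_exponent_le (by norm_num) hα1
    rw [Real.rpow_one] at this
    have := hT0.le.trans hTR
    gcongr
  set Λ : ℕ → ℝ := fun j => L (m + j) ^ (1 - σ) with hΛ
  have hg : ∀ j < k, KickBound (K₀ * T) (Λ (j + 1)) (f (m + (j + 1))) := fun j _ =>
    (hf _ (by omega)).kickBound hK₀ hσ (by linarith [hL1 j]) (hTj _)
  set N := ∏ j ∈ Finset.range m, (K₀ * L (j + 1) + 1) with hN
  have hN0 : 0 < N := Finset.prod_pos fun j _ => by have := hLpos (j + 1); positivity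
  set U := ∏ j ∈ Finset.range k, (Λ (j + 1) / 2) with hU
  have hNU : N * √(L (m + 1)) ≤ U := prod_mul_sqrt_le_prod hσ hK₀ hpos hL h256 hLK hk
  have hs0 : 0 < √(L (m + 1)) := Real.sqrt_pos.2 (hLpos _)
  have hU0 : 0 < U := (mul_pos hN0 hs0).trans_le hNU
  have hA := IsHolder.norm_nonneg (α := α) φ
  have hLip : ∀ p q, dist (kickCompInv f m p) (kickCompInv f m q) ≤ N * dist p q := fun p q =>
    dist_kickCompInv_le (K := fun j => K₀ * L j) (fun j hj _ =>
      ⟨(hf j hj).isCircleLift, (hf j hj).differentiable, (hf j hj).abs_deriv_le⟩) p q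
  have hcont : Continuous (kickCompInv f m) :=
    (LipschitzWith.of_dist_le_mul (K := ⟨N, hN0.le⟩) hLip).continuous
  have key := abs_integral_mul_kickComp_le hc (k := k) (g := fun j => f (m + j)) (by omega) hg
    (φ := fun p => φ (kickCompInv f m p)) (A := holderNorm α φ) (e₁ := 2 * R) (e₂ := 2 * R)
    (β := 4 * M₀ * K₁ * T) (δ := τ / N) (ε := τ)
    ((hφ.continuous hα).comp hcont) hH (fun p => hφ.abs_le hα _) hHB (by positivity) hτ0
    (fun p r hr0 hr => ?_) (fun p r hr0 hr => ?_) h0 ?_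
  · refine key.trans ?_
    gcongr
    have e1 : 2 / (τ / N * U) ≤ 2 * T := by
      rw [div_le_iff₀ (by positivity)]
      have h1 : τ / N * (N * √(L (m + 1))) ≤ τ / N * U := by gcongr
      have h2 : τ / N * (N * √(L (m + 1))) = τ * √(L (m + 1)) := by field_simp
      have h3 := hsq 0
      rw [zero_add] at h3
      have h4 : T * √(L (m + 1)) ≤ τ * √(L (m + 1)) := by gcongr
      have h5 : T * (T * √(L (m + 1))) ≤ T * (τ / N * U) :=
        mul_le_mul_of_nonneg_left (by linarith) hT0.le
      nlinarith
    have e2 : 4 / (τ * Λ k) ≤ 4 * T := by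
      obtain ⟨l, rfl⟩ : ∃ l, k = l + 1 := ⟨k - 1, by omega⟩
      have hl := hLpos (m + (l + 1))
      have hΛ0 : 0 < Λ (l + 1) := Real.rpow_pos_of_pos hl _
      rw [div_le_iff₀ (by positivity)]
      have h1 : √(L (m + (l + 1))) ≤ Λ (l + 1) := by
        have := two_mul_sqrt_le_rpow hσ (ℓ := L (m + (l + 1))) (by linarith [hL1 l])
        linarith [Real.sqrt_nonneg (L (m + (l + 1)))]
      have h3 := hsq l
      have h4 : T * √(L (m + (l + 1))) ≤ τ * Λ (l + 1) := by gcongr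
      have h5 : T * (T * √(L (m + (l + 1)))) ≤ T * (τ * Λ (l + 1)) := by gcongr
      nlinarith
    have e3 : 4 * M₀ * K₁ * T ≤ 4 * M₀ * K₁ * R := by gcongr
    have e4 : (4 * c + 8) * (K₀ * T) ≤ (4 * c + 8) * (K₀ * R) := by gcongr
    linarith
  · refine (hφ.abs_sub_le_dist hα _ _).trans ?_
    refine mul_le_mul_of_nonneg_left (le_trans ?_ hτR) hA
    refine Real.rpow_le_rpow (by positivity) ?_ hα.le
    have h1 : dist (p.1 + (r : UnitAddCircle), p.2) p ≤ r := by
      refine max_le ?_ (by simpa using hr0)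
      have := dist_coe_le r 0
      simpa [dist_eq_norm, abs_of_nonneg hr0] using this
    have h2 := hLip (p.1 + (r : UnitAddCircle), p.2) p
    have h3 : N * dist (p.1 + (r : UnitAddCircle), p.2) p ≤ N * (τ / N) := by
      gcongr; exact h1.trans hr
    have h4 : N * (τ / N) = τ := by field_simp
    linarith
  · refine (hHe p r hr0).trans (mul_le_mul_of_nonneg_left (le_trans ?_ hτR) hB)
    exact Real.rpow_le_rpow (by positivity) (by linarith) hα.le
  · calc _ ≤ ∑ j ∈ Finset.range k, 4 * M₀ * K₁ * L (m + (j + 1)) ^ (-σ) := by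
          refine Finset.sum_le_sum fun j _ => ?_
          have hl := hLpos (m + (j + 1))
          have h1 := (hf (m + (j + 1)) (by omega)).volume_le hK₁ hl
            (r := 2 * Λ (j + 1)) (by have := Real.rpow_nonneg hl.le (1 - σ); positivity)
          refine h1.trans (le_of_eq ?_)
          rw [hΛ]
          simp only
          rw [sub_eq_add_neg, Real.rpow_add hl, Real.rpow_one]
          field_simp
          ring
      _ ≤ _ := by
          rw [← Finset.mul_sum]
          gcongr
          exact sum_le_stripTail hpos hL hsum k

/-- The trivial bound by the suprema. -/
theorem abs_correlation_le {C A B : ℝ} {φ ψ : Torus2 → ℝ} {F : Torus2 → Torus2}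
    (hC : 2 ≤ C) (hφ : ∀ p, |φ p| ≤ A) (hψ : ∀ p, |ψ p| ≤ B) :
    |(∫ p, ψ (F p) * φ p) - (∫ p, φ p) * ∫ p, ψ p| ≤ C * B * A := by
  have hA : 0 ≤ A := (abs_nonneg _).trans (hφ 0)
  have hB : 0 ≤ B := (abs_nonneg _).trans (hψ 0)
  have h1 : |∫ p, ψ (F p) * φ p| ≤ B * A := abs_integral_le_of_forall_abs_le fun p => by
    rw [abs_mul]
    exact mul_le_mul (hψ _) (hφ _) (abs_nonneg _) hB
  have h2 : |∫ p, φ p| ≤ A := abs_integral_le_of_forall_abs_le hφ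
  have h3 : |∫ p, ψ p| ≤ B := abs_integral_le_of_forall_abs_le hψ
  calc _ ≤ B * A + A * B := by
        refine (abs_sub _ _).trans (add_le_add h1 ?_)
        rw [abs_mul]
        exact mul_le_mul h2 h3 (abs_nonneg _) hA
    _ = 2 * (B * A) := by ring
    _ ≤ C * (B * A) := by gcongr
    _ = _ := by ring

/-- The case in which the tail is small. The observable `ψ` is split into its deviation from the
mean on horizontal lines and the deviation of that mean, a function of the second coordinate, from
the integral. The second coordinate of `F^n` is the first coordinate of `F^(n-1)`, so that both
parts have mean zero on horizontal lines. -/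
theorem abs_correlation_le_stripTail {c : ℝ} (hc : ∀ t, |deriv slopeCutoff t| ≤ c)
    (hK₀ : 0 < K₀) (hK₁ : 0 < K₁) (hσ0 : 0 < σ) (hσ : σ ≤ 1 / 4) (hpos : 0 < L 0) (hL : Monotone L)
    (h256 : 256 ≤ L 1) (hLK : K₀ + 1 ≤ L 1) (hsum : Summable fun n : ℕ => L n ^ (-σ))
    (hf : ∀ n : ℕ, 1 ≤ n → AdmissibleKick K₀ K₁ M₀ (L n) (f n))
    (hα : 0 < α) (hα1 : α ≤ 1) (hT1 : stripTail L σ m ≤ 1) {n : ℕ} (hn : 5 * m + 2 ≤ n)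
    {φ ψ : Torus2 → ℝ} (hφ : IsHolder α φ) (hψ : IsHolder α ψ) :
    |(∫ p, ψ (kickComp f n p) * φ p) - (∫ p, φ p) * ∫ p, ψ p| ≤
      4 * (10 + 4 * M₀ * K₁ + (4 * c + 8) * K₀) * holderNorm α ψ * holderNorm α φ *
        stripTail L σ m ^ (α / (α + 2)) := by
  obtain ⟨k, rfl⟩ : ∃ k, n = m + (k + 1) := ⟨n - m - 1, by omega⟩
  have hcc := continuous_coe_circle
  set g : ℕ → ℝ → ℝ := fun j => f (m + j) with hg
  have hmeas : ∀ j, 1 ≤ j → Measurable (f j) := fun j hj => (hf j hj).contDiff.continuous.measurable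
  have hFm : MeasurePreserving (kickComp f m) := measurePreserving_kickComp fun j h _ => hmeas j h
  have hGm : ∀ l, Measurable (kickComp g l) := fun l =>
    (measurePreserving_kickComp (f := g) fun j h _ => hmeas _ (by omega)).measurable
  have hφc := hφ.continuous hα
  have hψc := hψ.continuous hα
  set B := holderNorm α ψ with hB
  have hB0 : 0 ≤ B := IsHolder.norm_nonneg ψ
  have hψB : ∀ p, |ψ p| ≤ B := hψ.abs_le hα
  have hInv : Measurable (kickCompInv f m) :=
    (LipschitzWith.of_dist_le_mul
      (K := ⟨∏ j ∈ Finset.range m, (K₀ * L (j + 1) + 1), Finset.prod_nonneg fun j _ => by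
        have := hpos.trans_le (hL (Nat.zero_le (j + 1))); positivity⟩)
      (dist_kickCompInv_le (f := f) (K := fun j => K₀ * L j) (fun j hj _ =>
      ⟨(hf j hj).isCircleLift, (hf j hj).differentiable,
        (hf j hj).abs_deriv_le⟩))).continuous.measurable
  -- the mean of `ψ` on the horizontal line at height `w`
  set mean : UnitAddCircle → ℝ := fun w => ∫ z : UnitAddCircle, ψ (z, w) with hmean
  have hmean_eq : mean = fun w => ∫ r in (0 : ℝ)..1, ψ ((r : UnitAddCircle), w) := by
    ext w
    have := UnitAddCircle.intervalIntegral_preimage 0 fun z => ψ (z, w)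
    rw [zero_add] at this
    exact this.symm
  have hmean_cont : Continuous mean := by
    rw [hmean_eq]
    exact intervalIntegral.continuous_parametric_intervalIntegral_of_continuous' (by fun_prop) 0 1
  have hψint : Integrable ψ := Integrable.of_bound hψc.aestronglyMeasurable B
    (Filter.Eventually.of_forall hψB)
  have hslice : ∀ w, Integrable fun z : UnitAddCircle => ψ (z, w) := fun w =>
    Integrable.of_bound (hψc.comp (by fun_prop)).aestronglyMeasurable B
      (Filter.Eventually.of_forall fun z => hψB _)
  have hmeanB : ∀ w, |mean w| ≤ B := fun w => abs_integral_le_of_forall_abs_le fun z => hψB _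
  have hmean_int : ∫ w, mean w = ∫ p, ψ p := (integral_prod_symm ψ hψint).symm
  have hmeanB' : |∫ w, mean w| ≤ B := abs_integral_le_of_forall_abs_le hmeanB
  have hdist : ∀ (p : Torus2) (r : ℝ), 0 ≤ r → dist (p.1, p.2 + (r : UnitAddCircle)) p ≤ r := by
    intro p r hr
    refine max_le (by simpa using hr) ?_
    have := dist_coe_le r 0
    simpa [dist_eq_norm, abs_of_nonneg hr] using this
  have hψe : ∀ (p : Torus2) (r : ℝ), 0 ≤ r →
      |ψ (p.1, p.2 + (r : UnitAddCircle)) - ψ p| ≤ B * (2 * r) ^ α := by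
    intro p r hr
    refine (hψ.abs_sub_le_dist hα _ _).trans ?_
    have := hdist p r hr
    gcongr
  have hmeane : ∀ (w : UnitAddCircle) (r : ℝ), 0 ≤ r →
      |mean (w + (r : UnitAddCircle)) - mean w| ≤ B * (2 * r) ^ α := by
    intro w r hr
    rw [hmean]
    simp only
    rw [← integral_sub (hslice _) (hslice _)]
    exact abs_integral_le_of_forall_abs_le fun z => hψe (z, w) r hr
  have I₁ := abs_integral_transport_le hc hK₀ hK₁ hσ0 hσ hpos hL h256 hLK hsum hf hα hα1 hT1
    (k := k + 1) (by omega) hφ (H := fun p => ψ p - mean p.2) (B := 2 * B)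
    (hψc.sub (hmean_cont.comp continuous_snd))
    (fun p => (abs_sub _ _).trans (by linarith [hψB p, hmeanB p.2]))
    (fun p r hr => by
      have e1 := hψe p r hr
      have e2 := hmeane p.2 r hr
      calc _ = |(ψ (p.1, p.2 + (r : UnitAddCircle)) - ψ p)
            - (mean (p.2 + (r : UnitAddCircle)) - mean p.2)| := by congr 1; ring
        _ ≤ _ := (abs_sub _ _).trans (by linarith))
    (fun w => by
      change ∫ z : UnitAddCircle, (ψ (z, w) - mean w) = 0
      rw [integral_sub (hslice w) (integrable_const _), integral_const, probReal_univ, one_smul]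
      exact sub_self _)
  have I₂ := abs_integral_transport_le hc hK₀ hK₁ hσ0 hσ hpos hL h256 hLK hsum hf hα hα1 hT1
    (k := k) (by omega) hφ (H := fun p => mean p.1 - ∫ w, mean w) (B := 2 * B)
    ((hmean_cont.comp continuous_fst).sub continuous_const)
    (fun p => (abs_sub _ _).trans (by linarith [hmeanB p.1]))
    (fun p r hr => by simp; positivity)
    (fun w => by
      rw [integral_sub (Integrable.of_bound hmean_cont.aestronglyMeasurable B
        (Filter.Eventually.of_forall hmeanB)) (integrable_const _), integral_const, probReal_univ,
        one_smul, sub_self])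
  have hbdd : ∀ (q : Torus2 → ℝ) (D : ℝ), Measurable q → (∀ p, |q p| ≤ D) →
      Integrable fun p => φ (kickCompInv f m p) * q p := by
    intro q D hq hqD
    refine Integrable.of_bound ((hφc.measurable.comp hInv).mul hq).aestronglyMeasurable
      (holderNorm α φ * D) (Filter.Eventually.of_forall fun p => ?_)
    rw [Real.norm_eq_abs, abs_mul]
    exact mul_le_mul (hφ.abs_le hα _) (hqD p) (abs_nonneg _) (IsHolder.norm_nonneg φ)
  have hchange : ∀ q : Torus2 → ℝ, Measurable q →
      ∫ p, φ p * q (kickComp f m p) = ∫ p, φ (kickCompInv f m p) * q p := by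
    intro q hq
    conv_rhs => rw [← hFm.map_eq]
    rw [integral_map (f := fun p => φ (kickCompInv f m p) * q p) hFm.measurable.aemeasurable
      ((hφc.measurable.comp hInv).mul hq).aestronglyMeasurable]
    simp only [kickCompInv_kickComp]
  have hsplit : (∫ p, ψ (kickComp f (m + (k + 1)) p) * φ p) - (∫ p, φ p) * ∫ p, ψ p =
      (∫ p, φ (kickCompInv f m p) * (ψ (kickComp g (k + 1) p) - mean (kickComp g (k + 1) p).2)) +
        ∫ p, φ (kickCompInv f m p) * (mean (kickComp g k p).1 - ∫ w, mean w) := by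
    have hq1 : Measurable fun p => ψ (kickComp g (k + 1) p) - mean (kickComp g (k + 1) p).2 :=
      (hψc.measurable.comp (hGm _)).sub
        (hmean_cont.measurable.comp (measurable_snd.comp (hGm _)))
    have hq2 : Measurable fun p => mean (kickComp g k p).1 - ∫ w, mean w :=
      (hmean_cont.measurable.comp (measurable_fst.comp (hGm _))).sub measurable_const
    have hq0 : Measurable fun p => ψ (kickComp g (k + 1) p) := hψc.measurable.comp (hGm _)
    have e1 : ∫ p, ψ (kickComp f (m + (k + 1)) p) * φ p =
        ∫ p, φ (kickCompInv f m p) * ψ (kickComp g (k + 1) p) := by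
      rw [← hchange (fun p => ψ (kickComp g (k + 1) p)) hq0]
      refine integral_congr_ae (Filter.Eventually.of_forall fun p => ?_)
      simp only [kickComp_add]
      rw [mul_comm]
    have e2 : (∫ p, φ p) * ∫ p, ψ p = ∫ p, φ (kickCompInv f m p) * ∫ w, mean w := by
      rw [← hchange (fun _ => ∫ w, mean w) measurable_const, integral_mul_const, hmean_int]
    rw [e1, e2, ← integral_sub (hbdd _ B hq0 fun p => hψB _)
      (hbdd _ B measurable_const fun _ => hmeanB'),
      ← integral_add (hbdd _ (2 * B) hq1 fun p => (abs_sub _ _).trans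
        (by linarith [hψB (kickComp g (k + 1) p), hmeanB (kickComp g (k + 1) p).2]))
      (hbdd _ (2 * B) hq2 fun p => (abs_sub _ _).trans (by linarith [hmeanB (kickComp g k p).1]))]
    refine integral_congr_ae (Filter.Eventually.of_forall fun p => ?_)
    simp only [kickComp, Function.comp_apply, kickMap_eq]
    ring
  rw [hsplit]
  refine (abs_add_le _ _).trans ((add_le_add I₁ I₂).trans (le_of_eq ?_))
  ring

end

theorem theoremC (K₀ K₁ : ℝ) (hK₀ : 0 < K₀) (hK₁ : 0 < K₁) (M₀ : ℕ)
    (η : ℝ) (hη : 1 / 2 < η) (hη' : η < 1) :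
    ∃ L₀' : ℝ, 0 < L₀' ∧ ∃ C : ℝ, 0 < C ∧
      ∀ (L : ℕ → ℝ) (f : ℕ → ℝ → ℝ),
        0 < L 0 → Monotone L → L₀' ≤ L 1 →
        Summable (fun n : ℕ => L n ^ (-((1 - η) / 2))) →
        (∀ n : ℕ, 1 ≤ n → AdmissibleKick K₀ K₁ M₀ (L n) (f n)) →
        ∀ (α : ℝ), 0 < α → α ≤ 1 →
        ∀ φ ψ : Torus2 → ℝ, IsHolder α φ → IsHolder α ψ →
        ∀ n : ℕ, (2 ≤ n ∨ L 0 ≤ L₀') →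
          |(∫ p : Torus2, ψ (kickComp f n p) * φ p) - (∫ p : Torus2, φ p) * ∫ p : Torus2, ψ p| ≤
            C * holderNorm α ψ * holderNorm α φ *
              max (L (n / 2) ^ (1 - 2 * η))
                ((∑' i : ℕ, L (n / 8 + i) ^ (-((1 - η) / 2))) ^ (α / (α + 2))) := by
  obtain ⟨c, hc0, hc⟩ := exists_deriv_slopeCutoff_le
  set L₀' : ℝ := max 256 (K₀ + 1) with hL₀'
  have hL₀'pos : 0 < L₀' := lt_of_lt_of_le (by norm_num) (le_max_left _ _)
  set C₁ : ℝ := 4 * (10 + 4 * M₀ * K₁ + (4 * c + 8) * K₀) with hC₁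
  have hC₁2 : 2 ≤ C₁ := by
    have : 0 ≤ 4 * M₀ * K₁ + (4 * c + 8) * K₀ := by positivity
    linarith
  set C₂ : ℝ := 2 * L₀' ^ (2 * η - 1) with hC₂
  have hC₂pos : 0 < C₂ := mul_pos two_pos (Real.rpow_pos_of_pos hL₀'pos _)
  refine ⟨L₀', hL₀'pos, C₁ + C₂, by linarith, ?_⟩
  intro L f hpos hL hL1 hsum hf α hα hα1 φ ψ hφ hψ n hn
  have hA := IsHolder.norm_nonneg (α := α) φ
  have hB := IsHolder.norm_nonneg (α := α) ψ
  set V := max (L (n / 2) ^ (1 - 2 * η))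
    ((∑' i : ℕ, L (n / 8 + i) ^ (-((1 - η) / 2))) ^ (α / (α + 2))) with hV
  have htriv : 2 ≤ (C₁ + C₂) * V → |(∫ p : Torus2, ψ (kickComp f n p) * φ p) -
      (∫ p : Torus2, φ p) * ∫ p : Torus2, ψ p| ≤
        (C₁ + C₂) * holderNorm α ψ * holderNorm α φ * V := fun h =>
    (abs_correlation_le h (hφ.abs_le hα) (hψ.abs_le hα)).trans (le_of_eq (by ring))
  rcases lt_or_ge n 2 with hn2 | hn2
  · have hL0 : L 0 ≤ L₀' := hn.resolve_left (by omega)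
    have h1 : L₀' ^ (1 - 2 * η) ≤ V := by
      refine le_trans ?_ (le_max_left _ _)
      rw [show n / 2 = 0 by omega]
      exact Real.rpow_le_rpow_of_nonpos hpos hL0 (by linarith)
    have h2 : C₂ * L₀' ^ (1 - 2 * η) = 2 := by
      rw [hC₂, mul_assoc, ← Real.rpow_add hL₀'pos]
      norm_num
    have h3 : 0 ≤ V := (Real.rpow_pos_of_pos hL₀'pos _).le.trans h1
    exact htriv (by nlinarith)
  rcases lt_or_ge 1 (stripTail L ((1 - η) / 2) (n / 8)) with hT | hT
  · have h1 : 1 ≤ V := (Real.one_le_rpow hT.le (by positivity)).trans (le_max_right _ _)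
    exact htriv (by nlinarith)
  · have h1 := abs_correlation_le_stripTail hc hK₀ hK₁ (by linarith) (by linarith) hpos hL
      ((le_max_left _ _).trans hL1) ((le_max_right _ _).trans hL1) hsum hf hα hα1 hT (n := n)
      (by omega) hφ hψ
    refine h1.trans ?_
    have h2 : stripTail L ((1 - η) / 2) (n / 8) ^ (α / (α + 2)) ≤ V := le_max_right _ _
    have h3 : 0 ≤ stripTail L ((1 - η) / 2) (n / 8) ^ (α / (α + 2)) :=
      Real.rpow_nonneg (tsum_nonneg fun i =>
        Real.rpow_nonneg (hpos.le.trans (hL (Nat.zero_le _))) _) _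
    gcongr
    linarith
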